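/- Let $0<q<1$, $a>0$, $0<\alpha<1$, $A_{q,a}=\{aq^n:n\in\mathbb N_0\}$ and $A^*_{q,a}=A_{q,a}\cup\{0\}$. Write $(z;q)_\infty=\prod_{i\ge0}(1-zq^i)$, $(z;q)_\nu=(z;q)_\infty/(zq^\nu;q)_\infty$, $\Gamma_q(x)=\frac{(q;q)_\infty}{(q^x;q)_\infty}(1-q)^{1-x}$, $\int_0^b f\,d_qt=(1-q)b\sum_{n\ge0}q^nf(bq^n)$, $\int_b^c=\int_0^c-\int_0^b$, $D_qf(x)=\frac{f(x)-f(qx)}{(1-q)x}$ and $D_{q^{-1}}f(x)=\frac{f(x)-f(x/q)}{x-x/q}$ for $x\ne0$, $D_{q^{-1}}f(0)=\lim_n\frac{f(aq^n)-f(0)}{aq^n}$, and, for $\beta>0$, $$I^\beta_{q,0^+}f(x)=\tfrac{x^{\beta-1}}{\Gamma_q(\beta)}\int_0^x(qt/x;q)_{\beta-1}f(t)\,d_qt,\qquad I^\beta_{q,a^-}f(x)=\tfrac1{\Gamma_q(\beta)}\int_{qx}^a t^{\beta-1}(qx/t;q)_{\beta-1}f(t)\,d_qt,$$ $I^\beta_{q,0^+}f(0)=0$,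 ${}^cD^\alpha_{q,0^+}f=I^{1-\alpha}_{q,0^+}D_qf$, $D^\alpha_{q,a^-}f=-\frac1qD_{q^{-1}}I^{1-\alpha}_{q,a^-}f$. Let $C(A^*_{q,a})$ be the space of functions $f$ on $A^*_{q,a}$ that are $q$-regular at zero, i.e. $\lim_nf(xq^n)=f(0)$ for all $x\in A^*_{q,a}$, and let $\mathcal{AC}_q(A^*_{q,a})$ be the set of those $f\in C(A^*_{q,a})$ for which $\sum_{j\ge0}|f(uq^j)-f(uq^{j+1})|$ is bounded uniformly in $u\in A^*_{q,a}$ (the domain of ${}^cD^\alpha_{q,0^+}$). For a bounded function $f$ on $A^*_{q,a}$ put $\|f\|=\sup_{A^*_{q,a}}|f|$. Let $p,r,w_\alpha$ be real functions on $A^*_{q,a}$ with $p\neq0$ and $w_\alpha>0$ there, and let $c_1,c_2,d_1,d_2\in\mathbb R$ with $c_1^2+c_2^2\ne0$ and $d_1^2+d_2^2\neq0$. For a scalar $\lambda$ consider the problem $$D^\alpha_{q,a^-}\big(p\,{}^cD^\alpha_{q,0^+}y\big)(x)+r(x)y(x)-\lambda w_\alpha(x)y(x)=0,\quad x\in A^*_{q,a},\qquad(3.1)$$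 $$c_1y(0)+c_2\,u_y(0)=0,\quad(3.2)\qquad d_1y(a)+d_2\,u_y(a/q)=0,\quad(3.3)$$ where $u_y=I^{1-\alpha}_{q,a^-}(p\,{}^cD^\alpha_{q,0^+}y)$. A solution is a function $y\in\mathcal{AC}_q(A^*_{q,a})\subset C(A^*_{q,a})$ satisfying (3.1)–(3.3). The value $u_y(a/q)$, which enters (3.3) and also (3.1) at $x=a$, lies outside $A^*_{q,a}$; it is either (i) given by the defining $q$-integral (so that it is $0$), or (ii) an additional boundary value attached to the solution: $y$ is a solution if there is some value $u_y(a/q)$ for which (3.1)–(3.3) hold. Functions $y$ and $\lambda$ are real, or both are complex. Put $\phi=I^\alpha_{q,0^+}I^\alpha_{q,a^-}1$, $\ \psi=I^\alpha_{q,0^+}\Big[\dfrac{a^{\alpha-1}(qx/a;q)_{\alpha-1}}{\Gamma_q(\alpha)p(x)}\Big]$, $\ \Delta=c_1d_2-c_2d_1+c_1d_1\psi(a)$, and, when $\Delta\neq0$, $$A=\Big\|\tfrac{c_2}{\Delta}\big[d_2+d_1(\psi(a)-\psi(\cdot))\big]\Big\|,\quad B=\Big\|\tfrac{d_1}{\Delta}\big[c_1\psi(\cdot)-c_2\big]\Big\|,\quad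 M_\phi=\|\phi\|,\quad m_p=\inf_{x\in A_{q,a}}|p(x)|.$$ Theorem. Assume $\Delta\ne0$, and let $\lambda$ be such that $r-\lambda w_\alpha$ is bounded on $A^*_{q,a}$ and $$\|r-\lambda w_\alpha\|<\frac{m_p}{M_\phi+B\,\phi(a)+A\,a\,m_p}.$$ Then, for each of the readings (i) and (ii) of $u_y(a/q)$, the problem (3.1)–(3.3) has exactly one solution $y_\lambda$ that is $q$-regular at zero on $A^*_{q,a}$; and if such a $\lambda$ is an eigenvalue (there is a nontrivial solution), it is simple: any two eigenfunctions are proportional. -/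

import Mathlib

open Filter Topology

namespace QFSLP

noncomputable section

/-- The set `A_{q,a} = {a qⁿ : n ∈ ℕ₀}`. -/
def grid (q a : ℝ) : Set ℝ := {x | ∃ n : ℕ, x = a * q ^ n}

/-- The set `A*_{q,a} = A_{q,a} ∪ {0}`. -/
def gridStar (q a : ℝ) : Set ℝ := grid q a ∪ {0}

/-- `(z; q)_∞`. -/
def qPochInf (q z : ℝ) : ℝ := ∏' i : ℕ, (1 - z * q ^ i)

/-- `(z; q)_ν = (z; q)_∞ / (z q^ν; q)_∞` for real `ν`. -/
def qPoch (q z ν : ℝ) : ℝ := qPochInf q z / qPochInf q (z * q ^ ν)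

/-- The `q`-gamma function `Γ_q(x) = (q; q)_∞ / (q^x; q)_∞ (1 - q)^{1 - x}`. -/
def qGamma (q x : ℝ) : ℝ := qPochInf q q / qPochInf q (q ^ x) * (1 - q) ^ (1 - x)

section Operators

variable {E : Type*} [NormedAddCommGroup E] [NormedSpace ℝ E]

/-- The Jackson integral `∫₀ᵇ f(t) d_q t = (1 - q) b ∑ qⁿ f(b qⁿ)`. -/
def jackson₀ (q b : ℝ) (f : ℝ → E) : E := ((1 - q) * b) • ∑' n : ℕ, q ^ n • f (b * q ^ n)

/-- The Jackson integral `∫_b^c f(t) d_q t`. -/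
def jackson (q b c : ℝ) (f : ℝ → E) : E := jackson₀ q c f - jackson₀ q b f

/-- Jackson's derivative `D_q f(x)` at `x ≠ 0`
(the value at zero never enters the operators below). -/
def qDeriv (q : ℝ) (f : ℝ → E) (x : ℝ) : E := ((1 - q) * x)⁻¹ • (f x - f (q * x))

/-- `d` is the value of `D_{q⁻¹} f` at the point `x` of `A*_{q,a}`: the difference quotient of `f`
at `x` and `x / q` if `x ≠ 0`, and the limit of `(f(a qⁿ) - f(0)) / (a qⁿ)` if `x = 0`. -/
def HasQInvDerivAt (q a : ℝ) (f : ℝ → E) (d : E) (x : ℝ) : Prop :=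
  (x ≠ 0 → d = (x - x / q)⁻¹ • (f x - f (x / q))) ∧
  (x = 0 → Tendsto (fun n : ℕ => (a * q ^ n)⁻¹ • (f (a * q ^ n) - f 0)) atTop (𝓝 d))

/-- The left sided Riemann–Liouville operator
`I_{q,0⁺}^β f(x) = x^{β-1} / Γ_q(β) ∫₀ˣ (qt/x; q)_{β-1} f(t) d_q t`. -/
def leftInt (q β : ℝ) (f : ℝ → E) (x : ℝ) : E :=
  (x ^ (β - 1) / qGamma q β) • jackson q 0 x (fun t => qPoch q (q * t / x) (β - 1) • f t)

/-- The right sided Riemann–Liouville operator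
`I_{q,a⁻}^β f(x) = 1 / Γ_q(β) ∫_{qx}^a t^{β-1} (qx/t; q)_{β-1} f(t) d_q t`. -/
def rightInt (q a β : ℝ) (f : ℝ → E) (x : ℝ) : E :=
  (1 / qGamma q β) •
    jackson q (q * x) a (fun t => (t ^ (β - 1) * qPoch q (q * x / t) (β - 1)) • f t)

/-- The left sided Caputo derivative of order `0 < α < 1`,
`ᶜD_{q,0⁺}^α f = I_{q,0⁺}^{1-α} D_q f`. -/
def leftCaputo (q α : ℝ) (f : ℝ → E) : ℝ → E := leftInt q (1 - α) (qDeriv q f)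

/-- `f` is `q`-regular at zero on `A*_{q,a}`, i.e. `f ∈ C(A*_{q,a})`. -/
def QRegular (q a : ℝ) (f : ℝ → E) : Prop :=
  ∀ x ∈ gridStar q a, Tendsto (fun n : ℕ => f (x * q ^ n)) atTop (𝓝 (f 0))

/-- `f` is `q`-absolutely continuous on `A*_{q,a}`, i.e. `f ∈ 𝒜𝒞_q(A*_{q,a})`; for `0 < α < 1` this
is the domain of the left sided Caputo derivative. -/
def QAbsCont (q a : ℝ) (f : ℝ → E) : Prop :=
  QRegular q a f ∧ ∃ K : ℝ, ∀ u ∈ gridStar q a, ∀ N : ℕ,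
    ∑ j ∈ Finset.range N, ‖f (u * q ^ j) - f (u * q ^ (j + 1))‖ ≤ K

/-- The norm `‖f‖ = sup {|f(x qⁿ)| : x ∈ A*_{q,a}, n ∈ ℕ₀}` (for `f` bounded on `A*_{q,a}`). -/
def supNorm (q a : ℝ) (f : ℝ → E) : ℝ :=
  sSup {s | ∃ x ∈ gridStar q a, ∃ n : ℕ, s = ‖f (x * q ^ n)‖}

end Operators

/-- `m_p = inf {|p(x)| : x ∈ A_{q,a}}`. -/
def mInf (q a : ℝ) (p : ℝ → ℝ) : ℝ := sInf {s | ∃ x ∈ grid q a, s = |p x|}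

/-- `φ = I_{q,0⁺}^α I_{q,a⁻}^α 1`. -/
def phi (q a α : ℝ) : ℝ → ℝ := leftInt q α (rightInt q a α (fun _ => (1 : ℝ)))

/-- `ψ_{α,a} = I_{q,0⁺}^α [a^{α-1} (qx/a; q)_{α-1} / (Γ_q(α) p(x))]`. -/
def psi (q a α : ℝ) (p : ℝ → ℝ) : ℝ → ℝ :=
  leftInt q α (fun x => a ^ (α - 1) * qPoch q (q * x / a) (α - 1) / (qGamma q α * p x))

/-- `Δ = c₁ d₂ - c₂ d₁ + c₁ d₁ ψ_{α,a}(a)`. -/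
def bdet (q a α : ℝ) (p : ℝ → ℝ) (c₁ c₂ d₁ d₂ : ℝ) : ℝ :=
  c₁ * d₂ - c₂ * d₁ + c₁ * d₁ * psi q a α p a

/-- `A(x) = c₂ / Δ [d₂ + d₁ (ψ_{α,a}(a) - ψ_{α,a}(x))]`. -/
def coefA (q a α : ℝ) (p : ℝ → ℝ) (c₁ c₂ d₁ d₂ : ℝ) (x : ℝ) : ℝ :=
  c₂ / bdet q a α p c₁ c₂ d₁ d₂ * (d₂ + d₁ * (psi q a α p a - psi q a α p x))

/-- `B(x) = d₁ / Δ [c₁ ψ_{α,a}(x) - c₂]`. -/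
def coefB (q a α : ℝ) (p : ℝ → ℝ) (c₁ c₂ d₁ d₂ : ℝ) (x : ℝ) : ℝ :=
  d₁ / bdet q a α p c₁ c₂ d₁ d₂ * (c₁ * psi q a α p x - c₂)

section Problem

variable {𝕜 : Type*} [RCLike 𝕜]

/-- The function `I_{q,a⁻}^{1-α} (p ᶜD_{q,0⁺}^α y)`. -/
def flux (q a α : ℝ) (p : ℝ → ℝ) (y : ℝ → 𝕜) : ℝ → 𝕜 :=
  rightInt q a (1 - α) (fun t => p t • leftCaputo q α y t)

/-- The fractional `q`-Sturm–Liouville equation on `A*_{q,a}` with both boundary conditions, for `y`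
in the domain of the operator, where `u` stands for `I_{q,a⁻}^{1-α} (p ᶜD_{q,0⁺}^α y)`, so that
`-(1/q) D_{q⁻¹} u` is the right sided Riemann–Liouville derivative
`D_{q,a⁻}^α (p ᶜD_{q,0⁺}^α y)`. -/
def SolvesWith (q a : ℝ) (r w : ℝ → ℝ) (c₁ c₂ d₁ d₂ : ℝ) (lam : 𝕜)
    (u y : ℝ → 𝕜) : Prop :=
  QAbsCont q a y ∧
  (∀ x ∈ gridStar q a, ∃ d : 𝕜, HasQInvDerivAt q a u d x ∧
    (-(1 / q)) • d + r x • y x - lam * (w x • y x) = 0) ∧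
  c₁ • y 0 + c₂ • u 0 = 0 ∧
  d₁ • y a + d₂ • u (a / q) = 0

/-- Solutions of the regular problem, with the right sided operator at the point `a / q` (which lies
outside `A*_{q,a}`) evaluated by its defining integral `∫_a^a`, that is, with value `0`. -/
def IsSolution (q a α : ℝ) (p r w : ℝ → ℝ) (c₁ c₂ d₁ d₂ : ℝ) (lam : 𝕜) (y : ℝ → 𝕜) : Prop :=
  SolvesWith q a r w c₁ c₂ d₁ d₂ lam (flux q a α p y) y

/-- Solutions of the regular problem, where `I_{q,a⁻}^{1-α} (p ᶜD_{q,0⁺}^α y)` is prescribed on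
`A*_{q,a}` only and its value at the outer point `a / q` is a boundary datum of the solution. -/
def IsSolutionExt (q a α : ℝ) (p r w : ℝ → ℝ) (c₁ c₂ d₁ d₂ : ℝ) (lam : 𝕜) (y : ℝ → 𝕜) : Prop :=
  ∃ u : ℝ → 𝕜, Set.EqOn u (flux q a α p y) (gridStar q a) ∧
    SolvesWith q a r w c₁ c₂ d₁ d₂ lam u y

/-- A problem for functions on `A*_{q,a}` has exactly one solution. -/
def UniquelySolvable (q a : ℝ) (Sol : (ℝ → 𝕜) → Prop) : Prop :=
  ∃ y, Sol y ∧ ∀ z, Sol z → Set.EqOn z y (gridStar q a)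

/-- `y` is a solution that is nontrivial on `A*_{q,a}`. -/
def IsEigenfunction (q a : ℝ) (Sol : (ℝ → 𝕜) → Prop) (y : ℝ → 𝕜) : Prop :=
  Sol y ∧ ∃ x ∈ gridStar q a, y x ≠ 0

/-- If there are nontrivial solutions, they are unique up to a constant factor. -/
def SimpleIfEigenvalue (q a : ℝ) (Sol : (ℝ → 𝕜) → Prop) : Prop :=
  ∀ y z, IsEigenfunction q a Sol y → IsEigenfunction q a Sol z →
    ∃ k : 𝕜, Set.EqOn z (fun x => k * y x) (gridStar q a)

end Problem

end

end QFSLP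

/-!
The `q`-Vandermonde convolution of the coefficients `(q^β; q)_n / (q; q)_n` makes the left and the
right sided fractional integrals semigroups on the grid, so fractional derivatives can be integrated
back. A solution of `D_{q,a⁻}^α (p ᶜD_{q,0⁺}^α y) = -f` therefore satisfies
`y = y(0) + ψ u(a/q) - T f`, where `T f = I_{q,0⁺}^α [p⁻¹ I_{q,a⁻}^α f]` and the boundary value
`u(a/q)` enters as a point mass at `a`. Eliminating `y(0)` and `u(a/q)` through the boundary
conditions gives `y = A (u(a/q) - u(0)) + B T f(a) - T f`, with `A` and `B` denoting the coefficient
functions. Since `‖u(a/q) - u(0)‖ ≤ a ‖f‖` and `‖T f‖ ≤ ‖f‖ φ / m_p`, for `f = (r - λ w) y` the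
smallness of `r - λ w` yields `‖y‖ ≤ κ ‖y‖` with `κ < 1`, and only the zero function is a solution.
-/

namespace QFSLP

open Finset

section QBinomial

open PowerSeries

theorem one_sub_X_mul_eq_iff {R : Type*} [CommRing R] {q z : R} {P : R⟦X⟧} :
    (1 - X) * P = (1 - C z * X) * rescale q P ↔
      ∀ n, coeff (n + 1) P * (1 - q ^ (n + 1)) = coeff n P * (1 - z * q ^ n) := by
  have hzero : coeff 0 ((1 - X) * P) = coeff 0 ((1 - C z * X) * rescale q P) := by
    simp only [sub_mul, one_mul, mul_assoc, map_sub, coeff_zero_X_mul, coeff_C_mul, coeff_rescale,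
      pow_zero, mul_zero]
  have hsucc (n : ℕ) : coeff (n + 1) ((1 - X) * P) - coeff (n + 1) ((1 - C z * X) * rescale q P) =
      coeff (n + 1) P * (1 - q ^ (n + 1)) - coeff n P * (1 - z * q ^ n) := by
    simp only [sub_mul, one_mul, mul_assoc, map_sub, coeff_succ_X_mul, coeff_C_mul, coeff_rescale]
    ring
  refine ⟨fun h n => sub_eq_zero.1 (by rw [← hsucc, h, sub_self]), fun h => ext fun n => ?_⟩
  cases n with
  | zero => exact hzero
  | succ n => exact sub_eq_zero.1 (by rw [hsucc, h, sub_self])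

variable {K : Type*} [Field K]

/-- The coefficients `(x; q)_m / (q; q)_m` of the `q`-binomial series. -/
def qBinomCoeff (q x : K) (m : ℕ) : K :=
  ∏ i ∈ range m, (1 - x * q ^ i) / (1 - q ^ (i + 1))

/-- The `q`-binomial series `∑ (x; q)_m / (q; q)_m Xᵐ`, which is `(xX; q)_∞ / (X; q)_∞`. -/
def qBinomSeries (q x : K) : K⟦X⟧ := PowerSeries.mk (qBinomCoeff q x)

variable {q : K}

theorem qBinomCoeff_zero (q x : K) : qBinomCoeff q x 0 = 1 := prod_range_zero _

theorem qBinomCoeff_succ_mul (hq : ∀ n, q ^ (n + 1) ≠ 1) (x : K) (n : ℕ) :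
    qBinomCoeff q x (n + 1) * (1 - q ^ (n + 1)) = qBinomCoeff q x n * (1 - x * q ^ n) := by
  rw [qBinomCoeff, prod_range_succ, ← qBinomCoeff, mul_assoc,
    div_mul_cancel₀ _ (sub_ne_zero.2 (hq n).symm)]

theorem qBinomCoeff_self (hq : ∀ n, q ^ (n + 1) ≠ 1) (m : ℕ) : qBinomCoeff q q m = 1 :=
  prod_eq_one fun i _ => by rw [← pow_succ', div_self (sub_ne_zero.2 (hq i).symm)]

theorem one_sub_X_mul_qBinomSeries (hq : ∀ n, q ^ (n + 1) ≠ 1) (x : K) :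
    (1 - X) * qBinomSeries q x = (1 - C x * X) * rescale q (qBinomSeries q x) :=
  one_sub_X_mul_eq_iff.2 fun n => by
    simpa only [qBinomSeries, coeff_mk] using qBinomCoeff_succ_mul hq x n

theorem eq_qBinomSeries (hq : ∀ n, q ^ (n + 1) ≠ 1) {x : K} {P : K⟦X⟧} (h0 : coeff 0 P = 1)
    (h : (1 - X) * P = (1 - C x * X) * rescale q P) : P = qBinomSeries q x := by
  ext n
  rw [qBinomSeries, coeff_mk]
  induction n with
  | zero => rw [h0, qBinomCoeff_zero]
  | succ n ih =>
    refine mul_right_cancel₀ (sub_ne_zero.2 (hq n).symm) ?_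
    rw [one_sub_X_mul_eq_iff.1 h n, ih, qBinomCoeff_succ_mul hq]

theorem rescale_qBinomSeries_mul (hq : ∀ n, q ^ (n + 1) ≠ 1) (x y : K) :
    rescale y (qBinomSeries q x) * qBinomSeries q y = qBinomSeries q (x * y) := by
  have hC : rescale y (C x) = C x := by
    ext n
    rw [coeff_rescale, coeff_C]
    split_ifs with h <;> simp [h]
  have hx : (1 - C y * X) * rescale y (qBinomSeries q x) =
      (1 - C (x * y) * X) * rescale q (rescale y (qBinomSeries q x)) := by
    have := congrArg (rescale y) (one_sub_X_mul_qBinomSeries hq x)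
    simpa only [map_mul, map_sub, map_one, rescale_X, hC, ← mul_assoc, rescale_rescale,
      mul_comm y q] using this
  have hne : (1 - C y * X : K⟦X⟧) ≠ 0 := fun h => by simpa using congrArg (coeff 0) h
  refine eq_qBinomSeries hq ?_ (mul_left_cancel₀ hne ?_)
  · simp [qBinomSeries, qBinomCoeff_zero, coeff_mul, coeff_rescale, -coeff_zero_eq_constantCoeff]
  · rw [map_mul (rescale q)]
    linear_combination (1 - X) * qBinomSeries q y * hx + (1 - C (x * y) * X) *
      rescale q (rescale y (qBinomSeries q x)) * one_sub_X_mul_qBinomSeries hq y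

/-- The `q`-Vandermonde identity, which is what makes the fractional `q`-integrals semigroups. -/
theorem sum_antidiagonal_pow_mul_qBinomCoeff (hq : ∀ n, q ^ (n + 1) ≠ 1) (x y : K) (m : ℕ) :
    ∑ ij ∈ antidiagonal m, y ^ ij.1 * qBinomCoeff q x ij.1 * qBinomCoeff q y ij.2 =
      qBinomCoeff q (x * y) m := by
  have := congrArg (coeff m) (rescale_qBinomSeries_mul hq x y)
  simpa only [coeff_mul, coeff_rescale, qBinomSeries, coeff_mk] using this

end QBinomial
section QPochhammer

variable {q : ℝ}

theorem summable_norm_neg_mul_pow (hq : ‖q‖ < 1) (z : ℝ) :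
    Summable fun i : ℕ => ‖-(z * q ^ i)‖ := by
  simpa only [norm_neg, norm_mul, norm_pow] using
    (summable_geometric_of_lt_one (norm_nonneg q) hq).mul_left ‖z‖

theorem qPochInf_eq_prod_mul (hq : ‖q‖ < 1) (z : ℝ) (m : ℕ) :
    qPochInf q z = (∏ i ∈ range m, (1 - z * q ^ i)) * qPochInf q (z * q ^ m) := by
  have hshift (i : ℕ) : 1 - z * q ^ m * q ^ i = 1 - z * q ^ (i + m) := by ring
  have hmul : Multipliable fun i : ℕ => 1 - z * q ^ (i + m) := by
    simp only [← hshift, sub_eq_add_neg]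
    exact multipliable_one_add_of_summable (summable_norm_neg_mul_pow hq (z * q ^ m))
  simp only [qPochInf, hshift]
  exact (Multipliable.prod_mul_tprod_nat_mul' (f := fun i : ℕ => 1 - z * q ^ i) hmul).symm

theorem qPochInf_eq_zero {z : ℝ} {j : ℕ} (h : z * q ^ j = 1) : qPochInf q z = 0 :=
  tprod_of_exists_eq_zero ⟨j, by rw [h, sub_self]⟩

theorem qPochInf_ne_zero (hq : ‖q‖ < 1) {z : ℝ} (hz : ∀ i : ℕ, z * q ^ i ≠ 1) :
    qPochInf q z ≠ 0 := by
  simpa only [qPochInf, sub_eq_add_neg] using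
    tprod_one_add_ne_zero_of_summable (f := fun i : ℕ => -(z * q ^ i))
      (fun i => by rw [← sub_eq_add_neg]; exact sub_ne_zero.2 (hz i).symm)
      (summable_norm_neg_mul_pow hq z)

theorem qPoch_inv_pow (hq : q ≠ 0) (j : ℕ) (ν : ℝ) : qPoch q ((q ^ j)⁻¹) ν = 0 := by
  rw [qPoch, qPochInf_eq_zero (inv_mul_cancel₀ (pow_ne_zero j hq)), zero_div]

theorem norm_lt_one (hq₀ : 0 < q) (hq₁ : q < 1) : ‖q‖ < 1 := by
  rwa [Real.norm_of_nonneg hq₀.le]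

theorem pow_succ_ne_one (hq₀ : 0 < q) (hq₁ : q < 1) (n : ℕ) : q ^ (n + 1) ≠ 1 :=
  (pow_lt_one₀ hq₀.le hq₁ n.succ_ne_zero).ne

theorem qPochInf_rpow_ne_zero (hq₀ : 0 < q) (hq₁ : q < 1) {β : ℝ} (hβ : 0 < β) :
    qPochInf q (q ^ β) ≠ 0 :=
  qPochInf_ne_zero (norm_lt_one hq₀ hq₁) fun i =>
    (mul_lt_one_of_nonneg_of_lt_one_left (by positivity) (Real.rpow_lt_one hq₀.le hq₁ hβ)
      (pow_le_one₀ hq₀.le hq₁.le)).ne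

theorem qGamma_ne_zero (hq₀ : 0 < q) (hq₁ : q < 1) {β : ℝ} (hβ : 0 < β) : qGamma q β ≠ 0 := by
  have hq := qPochInf_rpow_ne_zero hq₀ hq₁ one_pos
  rw [Real.rpow_one] at hq
  exact mul_ne_zero (div_ne_zero hq (qPochInf_rpow_ne_zero hq₀ hq₁ hβ))
    (Real.rpow_pos_of_pos (sub_pos.2 hq₁) _).ne'

theorem qPochInf_div_qPochInf_self (hq : ‖q‖ < 1) (x : ℝ) (m : ℕ) :
    qPochInf q x / qPochInf q q =
      qBinomCoeff q x m * (qPochInf q (x * q ^ m) / qPochInf q (q ^ (m + 1))) := by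
  rw [qPochInf_eq_prod_mul hq q m, qPochInf_eq_prod_mul hq x m, mul_div_mul_comm, qBinomCoeff,
    prod_div_distrib]
  simp only [pow_succ']

theorem qPoch_pow_succ (hq₀ : 0 < q) (hq₁ : q < 1) {β : ℝ} (hβ : 0 < β) (m : ℕ) :
    qPoch q (q ^ (m + 1)) (β - 1) = qGamma q β * (1 - q) ^ (β - 1) * qBinomCoeff q (q ^ β) m := by
  have hβ' := qPochInf_rpow_ne_zero hq₀ hq₁ hβ
  have hquot := qPochInf_div_qPochInf_self (norm_lt_one hq₀ hq₁) (q ^ β) m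
  have hq := qPochInf_rpow_ne_zero hq₀ hq₁ one_pos
  rw [Real.rpow_one] at hq
  have hne : qPochInf q (q ^ β * q ^ m) ≠ 0 ∧ qPochInf q (q ^ (m + 1)) ≠ 0 := by
    constructor <;> intro h <;> rw [h] at hquot <;> simp [hβ', hq] at hquot
  have hshift : q ^ (m + 1) * q ^ (β - 1) = q ^ β * q ^ m := by
    rw [Real.rpow_sub_one hq₀.ne', pow_succ]
    field_simp
  have hpow : (1 - q) ^ (1 - β) * (1 - q) ^ (β - 1) = 1 := by
    rw [← Real.rpow_add (sub_pos.2 hq₁)]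
    simp
  obtain ⟨hβm, hm⟩ := hne
  rw [qPoch, hshift, qGamma, mul_assoc (_ / _), hpow, mul_one]
  field_simp at hquot ⊢
  linear_combination hquot

theorem qBinomCoeff_nonneg (hq₀ : 0 < q) (hq₁ : q < 1) {x : ℝ} (hx : x ≤ 1) (m : ℕ) :
    0 ≤ qBinomCoeff q x m :=
  prod_nonneg fun i _ => div_nonneg
    (sub_nonneg.2 (mul_le_one₀ hx (by positivity) (pow_le_one₀ hq₀.le hq₁.le)))
    (sub_nonneg.2 (pow_le_one₀ hq₀.le hq₁.le))

theorem qBinomCoeff_rpow_nonneg (hq₀ : 0 < q) (hq₁ : q < 1) {β : ℝ} (hβ : 0 ≤ β) (m : ℕ) :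
    0 ≤ qBinomCoeff q (q ^ β) m :=
  qBinomCoeff_nonneg hq₀ hq₁ (Real.rpow_le_one hq₀.le hq₁.le hβ) m

theorem exists_norm_qBinomCoeff_le (hq : ‖q‖ < 1) (x : ℝ) :
    ∃ C, ∀ m, ‖qBinomCoeff q x m‖ ≤ C := by
  have htendsto (z : ℝ) :
      Tendsto (fun m => ∏ i ∈ range m, (1 - z * q ^ i)) atTop (𝓝 (qPochInf q z)) := by
    simpa only [qPochInf, sub_eq_add_neg] using
      (multipliable_one_add_of_summable (summable_norm_neg_mul_pow hq z)).tendsto_prod_tprod_nat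
  have hself : qPochInf q q ≠ 0 := qPochInf_ne_zero hq fun i h => by
    rw [← pow_succ'] at h
    exact (pow_lt_one₀ (norm_nonneg q) hq i.succ_ne_zero).ne (by rw [← norm_pow, h, norm_one])
  obtain ⟨C, hC⟩ := ((htendsto x).div (htendsto q) hself).norm.bddAbove_range
  refine ⟨C, fun m => le_of_eq_of_le ?_ (hC ⟨m, rfl⟩)⟩
  simp only [qBinomCoeff, prod_div_distrib, pow_succ', Pi.div_apply]

end QPochhammer
section Grid

variable {q a x : ℝ}

theorem self_mem_grid (q a : ℝ) : a ∈ grid q a := ⟨0, by simp⟩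

theorem mul_pow_mem_grid (q a : ℝ) (n : ℕ) : a * q ^ n ∈ grid q a := ⟨n, rfl⟩

theorem grid_subset (hx : x ∈ grid q a) : grid q x ⊆ grid q a := by
  obtain ⟨m, rfl⟩ := hx
  rintro _ ⟨n, rfl⟩
  exact ⟨m + n, by ring⟩

theorem mul_pow_mem_gridStar (hx : x ∈ gridStar q a) (n : ℕ) : x * q ^ n ∈ gridStar q a := by
  rcases hx with hx | rfl
  · exact Or.inl (grid_subset hx (mul_pow_mem_grid q x n))
  · simp [gridStar]

theorem pos_of_mem_grid (hq₀ : 0 < q) (ha : 0 < a) (hx : x ∈ grid q a) : 0 < x := by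
  obtain ⟨n, rfl⟩ := hx
  positivity

theorem le_of_mem_grid (hq₀ : 0 < q) (hq₁ : q < 1) (ha : 0 < a) (hx : x ∈ grid q a) : x ≤ a := by
  obtain ⟨n, rfl⟩ := hx
  exact mul_le_of_le_one_right ha.le (pow_le_one₀ hq₀.le hq₁.le)

end Grid

section RightInt

variable {E : Type*} [NormedAddCommGroup E] [NormedSpace ℝ E] {q a β : ℝ}

theorem rightInt_eq_sum (hq₀ : 0 < q) (hq₁ : q < 1) (ha : 0 < a) (hβ : 0 < β)
    (f : ℝ → E) (n : ℕ) : rightInt q a β f (a * q ^ n) = (((1 - q) * a) ^ β) •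
      ∑ ki ∈ antidiagonal n, ((q ^ β) ^ ki.1 * qBinomCoeff q (q ^ β) ki.2) • f (a * q ^ ki.1) := by
  set g : ℝ → E := fun t => (t ^ (β - 1) * qPoch q (q * (a * q ^ n) / t) (β - 1)) • f t with hg
  have hg_tail (j : ℕ) : g (a * q ^ (n + 1 + j)) = 0 := by
    have : q * (a * q ^ n) / (a * q ^ (n + 1 + j)) = (q ^ j)⁻¹ := by
      rw [pow_add, pow_succ]
      field_simp
    simp only [hg, this, qPoch_inv_pow hq₀.ne', mul_zero, zero_smul]
  have hlower : jackson₀ q (q * (a * q ^ n)) g = 0 := by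
    have h (j : ℕ) : q * (a * q ^ n) * q ^ j = a * q ^ (n + 1 + j) := by ring
    simp only [jackson₀, h, hg_tail, smul_zero, tsum_zero]
  have hupper : jackson₀ q a g =
      ((1 - q) * a) • ∑ ki ∈ antidiagonal n, q ^ ki.1 • g (a * q ^ ki.1) := by
    rw [jackson₀, Nat.sum_antidiagonal_eq_sum_range_succ_mk, tsum_eq_sum fun k hk => ?_]
    obtain ⟨j, rfl⟩ := Nat.exists_eq_add_of_le (not_lt.1 (mem_range.not.1 hk))
    rw [hg_tail, smul_zero]
  have hΓ := qGamma_ne_zero hq₀ hq₁ hβ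
  have hq : 0 < 1 - q := sub_pos.2 hq₁
  rw [rightInt, jackson, hlower, sub_zero, hupper, smul_smul, smul_sum, smul_sum]
  refine sum_congr rfl fun ⟨k, i⟩ hki => ?_
  obtain rfl : k + i = n := mem_antidiagonal.1 hki
  have hquot : q * (a * q ^ (k + i)) / (a * q ^ k) = q ^ (i + 1) := by
    rw [pow_add, pow_succ]
    field_simp
  have hpow : (a * q ^ k) ^ β = a ^ β * (q ^ β) ^ k := by
    rw [Real.mul_rpow ha.le (by positivity), Real.rpow_pow_comm hq₀.le]
  simp only [hg]
  rw [hquot, qPoch_pow_succ hq₀ hq₁ hβ, smul_smul, smul_smul, smul_smul,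
    Real.rpow_sub_one (by positivity), Real.mul_rpow hq.le ha.le, hpow, Real.rpow_sub_one hq.ne']
  congr 1
  field_simp

theorem rightInt_one_eq_sum (hq₀ : 0 < q) (hq₁ : q < 1) (ha : 0 < a) (f : ℝ → E) (n : ℕ) :
    rightInt q a 1 f (a * q ^ n) =
      ((1 - q) * a) • ∑ k ∈ range (n + 1), q ^ k • f (a * q ^ k) := by
  rw [rightInt_eq_sum hq₀ hq₁ ha one_pos, Nat.sum_antidiagonal_eq_sum_range_succ_mk]
  simp only [Real.rpow_one, qBinomCoeff_self (pow_succ_ne_one hq₀ hq₁), mul_one]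

theorem rightInt_sub (hq₀ : 0 < q) (hq₁ : q < 1) (ha : 0 < a) (hβ : 0 < β) (f g : ℝ → E) {x : ℝ}
    (hx : x ∈ grid q a) :
    rightInt q a β (fun t => f t - g t) x = rightInt q a β f x - rightInt q a β g x := by
  obtain ⟨n, rfl⟩ := hx
  simp only [rightInt_eq_sum hq₀ hq₁ ha hβ, smul_sub, sum_sub_distrib]

theorem sum_antidiagonal_sum_antidiagonal {M : Type*} [AddCommMonoid M] (F : ℕ → ℕ → ℕ → M)
    (n : ℕ) : ∑ p ∈ antidiagonal n, ∑ r ∈ antidiagonal p.1, F r.1 r.2 p.2 =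
      ∑ p ∈ antidiagonal n, ∑ r ∈ antidiagonal p.2, F p.1 r.1 r.2 := by
  simp only [sum_sigma']
  refine sum_nbij' (fun s => ⟨(s.2.1, s.2.2 + s.1.2), (s.2.2, s.1.2)⟩)
    (fun s => ⟨(s.1.1 + s.2.1, s.2.2), (s.1.1, s.2.1)⟩) ?_ ?_ ?_ ?_ fun _ _ => rfl <;>
  · rintro ⟨⟨i, j⟩, k, l⟩ h
    simp only [mem_sigma, HasAntidiagonal.mem_antidiagonal] at h ⊢
    obtain ⟨rfl, rfl⟩ := h
    simp [add_assoc]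

theorem rightInt_rightInt (hq₀ : 0 < q) (hq₁ : q < 1) (ha : 0 < a) {α : ℝ} (hα : 0 < α)
    (hβ : 0 < β) (f : ℝ → E) {x : ℝ} (hx : x ∈ grid q a) :
    rightInt q a β (rightInt q a α f) x = rightInt q a (α + β) f x := by
  obtain ⟨n, rfl⟩ := hx
  have hb : 0 < (1 - q) * a := mul_pos (sub_pos.2 hq₁) ha
  simp only [rightInt_eq_sum hq₀ hq₁ ha hα, rightInt_eq_sum hq₀ hq₁ ha hβ,
    rightInt_eq_sum hq₀ hq₁ ha (add_pos hα hβ), Real.rpow_add hb, Real.rpow_add hq₀,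
    smul_comm _ (((1 - q) * a) ^ α), ← smul_sum]
  rw [smul_smul]
  congr 1
  set c := qBinomCoeff q with hc
  calc ∑ ki ∈ antidiagonal n, ((q ^ β) ^ ki.1 * c (q ^ β) ki.2) •
        ∑ lj ∈ antidiagonal ki.1, ((q ^ α) ^ lj.1 * c (q ^ α) lj.2) • f (a * q ^ lj.1)
    _ = ∑ ki ∈ antidiagonal n, ∑ lj ∈ antidiagonal ki.1,
        ((q ^ β) ^ (lj.1 + lj.2) * c (q ^ β) ki.2 * ((q ^ α) ^ lj.1 * c (q ^ α) lj.2)) •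
          f (a * q ^ lj.1) := by
      refine sum_congr rfl fun ki _ => ?_
      rw [smul_sum]
      refine sum_congr rfl fun lj hlj => ?_
      rw [smul_smul, HasAntidiagonal.mem_antidiagonal.1 hlj]
    _ = ∑ lm ∈ antidiagonal n, ∑ ji ∈ antidiagonal lm.2,
        ((q ^ β) ^ (lm.1 + ji.1) * c (q ^ β) ji.2 * ((q ^ α) ^ lm.1 * c (q ^ α) ji.1)) •
          f (a * q ^ lm.1) :=
      sum_antidiagonal_sum_antidiagonal (fun l j i =>
        ((q ^ β) ^ (l + j) * c (q ^ β) i * ((q ^ α) ^ l * c (q ^ α) j)) • f (a * q ^ l)) n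
    _ = ∑ lm ∈ antidiagonal n,
        ((q ^ α * q ^ β) ^ lm.1 * c (q ^ α * q ^ β) lm.2) • f (a * q ^ lm.1) := by
      refine sum_congr rfl fun lm _ => ?_
      rw [hc, ← sum_antidiagonal_pow_mul_qBinomCoeff (pow_succ_ne_one hq₀ hq₁), ← hc, mul_sum,
        sum_smul]
      refine sum_congr rfl fun ji _ => ?_
      congr 1
      ring

/-- `I_{q,a⁻}^β` is triangular on the grid with a nonvanishing diagonal. -/
theorem eqOn_of_rightInt_eqOn (hq₀ : 0 < q) (hq₁ : q < 1) (ha : 0 < a) (hβ : 0 < β) {f g : ℝ → E}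
    (h : Set.EqOn (rightInt q a β f) (rightInt q a β g) (grid q a)) : Set.EqOn f g (grid q a) := by
  rintro _ ⟨n, rfl⟩
  induction n using Nat.strong_induction_on with
  | _ n ih =>
    have hb : ((1 - q) * a) ^ β ≠ 0 :=
      (Real.rpow_pos_of_pos (mul_pos (sub_pos.2 hq₁) ha) _).ne'
    have hn := h (mul_pow_mem_grid q a n)
    rw [rightInt_eq_sum hq₀ hq₁ ha hβ, rightInt_eq_sum hq₀ hq₁ ha hβ,
      (smul_right_injective E hb).eq_iff,
      Nat.sum_antidiagonal_eq_sum_range_succ_mk, Nat.sum_antidiagonal_eq_sum_range_succ_mk,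
      sum_range_succ, sum_range_succ, sum_congr rfl fun k hk => by rw [ih k (mem_range.1 hk)],
      add_right_inj, Nat.sub_self, qBinomCoeff_zero, mul_one] at hn
    exact smul_right_injective E (pow_ne_zero n (Real.rpow_pos_of_pos hq₀ β).ne') hn

theorem norm_rightInt_le (hq₀ : 0 < q) (hq₁ : q < 1) (ha : 0 < a) (hβ : 0 < β) {f : ℝ → E} {N : ℝ}
    (hf : ∀ t ∈ grid q a, ‖f t‖ ≤ N) {x : ℝ} (hx : x ∈ grid q a) :
    ‖rightInt q a β f x‖ ≤ N * rightInt q a β (fun _ => (1 : ℝ)) x := by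
  obtain ⟨n, rfl⟩ := hx
  have hs : 0 ≤ ((1 - q) * a) ^ β := Real.rpow_nonneg (mul_nonneg (sub_nonneg.2 hq₁.le) ha.le) _
  rw [rightInt_eq_sum hq₀ hq₁ ha hβ, rightInt_eq_sum hq₀ hq₁ ha hβ, norm_smul,
    Real.norm_of_nonneg hs, smul_eq_mul, mul_left_comm, mul_sum]
  refine mul_le_mul_of_nonneg_left (norm_sum_le_of_le _ fun ki _ => ?_) hs
  have hc := qBinomCoeff_rpow_nonneg hq₀ hq₁ hβ.le ki.2
  rw [norm_smul, Real.norm_of_nonneg (by positivity), smul_eq_mul, mul_one, mul_comm]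
  exact mul_le_mul_of_nonneg_right (hf _ (mul_pow_mem_grid q a _)) (by positivity)

theorem rightInt_one_nonneg (hq₀ : 0 < q) (hq₁ : q < 1) (ha : 0 < a) (hβ : 0 < β) {x : ℝ}
    (hx : x ∈ grid q a) : 0 ≤ rightInt q a β (fun _ => (1 : ℝ)) x := by
  have h := norm_rightInt_le hq₀ hq₁ ha hβ (f := fun _ => (1 : ℝ)) (fun _ _ => norm_one.le) hx
  exact (norm_nonneg _).trans (h.trans_eq (one_mul _))

theorem exists_rightInt_one_le (hq₀ : 0 < q) (hq₁ : q < 1) (ha : 0 < a) (hβ : 0 < β) :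
    ∃ C, ∀ x ∈ grid q a, rightInt q a β (fun _ => (1 : ℝ)) x ≤ C := by
  obtain ⟨C, hC⟩ := exists_norm_qBinomCoeff_le (norm_lt_one hq₀ hq₁) (q ^ β)
  have hqβ : 0 ≤ q ^ β := Real.rpow_nonneg hq₀.le β
  have hgeom := summable_geometric_of_lt_one hqβ (Real.rpow_lt_one hq₀.le hq₁ hβ)
  refine ⟨((1 - q) * a) ^ β * ∑' k, (q ^ β) ^ k * C, ?_⟩
  rintro _ ⟨n, rfl⟩
  rw [rightInt_eq_sum hq₀ hq₁ ha hβ, smul_eq_mul, Nat.sum_antidiagonal_eq_sum_range_succ_mk]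
  refine mul_le_mul_of_nonneg_left ((sum_le_sum fun k _ => ?_).trans
    ((hgeom.mul_right C).sum_le_tsum _ fun k _ => ?_))
    (Real.rpow_nonneg (mul_nonneg (sub_nonneg.2 hq₁.le) ha.le) _)
  · rw [smul_eq_mul, mul_one]
    exact mul_le_mul_of_nonneg_left ((Real.le_norm_self _).trans (hC _)) (pow_nonneg hqβ k)
  · exact mul_nonneg (pow_nonneg hqβ k) ((norm_nonneg _).trans (hC 0))

/-- The `q`-analogue of `v` times the Dirac mass at `a`: its Jackson integral over `[0, a]` is `v`.
It turns the boundary value at `a / q` into a source term. -/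
noncomputable def pointMass (q a : ℝ) (v : E) : ℝ → E := Pi.single a (((1 - q) * a)⁻¹ • v)

theorem norm_pointMass_le (q a : ℝ) (v : E) (t : ℝ) :
    ‖pointMass q a v t‖ ≤ ‖((1 - q) * a)⁻¹ • v‖ := by
  by_cases h : t = a
  · rw [pointMass, h, Pi.single_eq_same]
  · rw [pointMass, Pi.single_eq_of_ne h, norm_zero]
    exact norm_nonneg _

theorem rightInt_pointMass_mul_pow (hq₀ : 0 < q) (hq₁ : q < 1) (ha : 0 < a) (hβ : 0 < β) (v : E)
    (n : ℕ) : rightInt q a β (pointMass q a v) (a * q ^ n) =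
      (((1 - q) * a) ^ (β - 1) * qBinomCoeff q (q ^ β) n) • v := by
  have hb : (1 - q) * a ≠ 0 := mul_ne_zero (sub_pos.2 hq₁).ne' ha.ne'
  have hoff {k : ℕ} (hk : k ≠ 0) : pointMass q a v (a * q ^ k) = 0 :=
    Pi.single_eq_of_ne (by simp [ha.ne', pow_eq_one_iff_of_nonneg hq₀.le hk, hq₁.ne]) _
  rw [rightInt_eq_sum hq₀ hq₁ ha hβ, sum_eq_single (0, n)]
  · rw [pow_zero, pow_zero, one_mul, mul_one, pointMass, Pi.single_eq_same, smul_smul, smul_smul,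
      Real.rpow_sub_one hb]
    congr 1
    ring
  · rintro ⟨k, i⟩ hki hne
    have hk : k ≠ 0 := by
      rintro rfl
      exact hne (by simpa [eq_comm] using HasAntidiagonal.mem_antidiagonal.1 hki)
    rw [hoff hk, smul_zero]
  · simp

theorem rightInt_pointMass (hq₀ : 0 < q) (hq₁ : q < 1) (ha : 0 < a) (hβ : 0 < β) (v : E) {x : ℝ}
    (hx : x ∈ grid q a) : rightInt q a β (pointMass q a v) x =
      (a ^ (β - 1) * qPoch q (q * x / a) (β - 1) / qGamma q β) • v := by
  obtain ⟨n, rfl⟩ := hx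
  have hΓ := qGamma_ne_zero hq₀ hq₁ hβ
  have hquot : q * (a * q ^ n) / a = q ^ (n + 1) := by
    rw [pow_succ]
    field_simp
  rw [rightInt_pointMass_mul_pow hq₀ hq₁ ha hβ, hquot, qPoch_pow_succ hq₀ hq₁ hβ,
    Real.mul_rpow (sub_nonneg.2 hq₁.le) ha.le]
  congr 1
  field_simp

theorem rightInt_one_pointMass (hq₀ : 0 < q) (hq₁ : q < 1) (ha : 0 < a) (v : E) {x : ℝ}
    (hx : x ∈ grid q a) : rightInt q a 1 (pointMass q a v) x = v := by
  obtain ⟨n, rfl⟩ := hx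
  rw [rightInt_pointMass_mul_pow hq₀ hq₁ ha one_pos, sub_self, Real.rpow_zero, Real.rpow_one,
    qBinomCoeff_self (pow_succ_ne_one hq₀ hq₁), one_mul, one_smul]

end RightInt

section Series

variable {E : Type*} [NormedAddCommGroup E]

theorem tsum_sub_succ {v : ℕ → E} {l : E} (hv : Tendsto v atTop (𝓝 l))
    (hs : Summable fun n => v n - v (n + 1)) : ∑' n, (v n - v (n + 1)) = v 0 - l := by
  refine tendsto_nhds_unique hs.hasSum.tendsto_sum_nat ?_
  simp only [sum_range_sub']
  exact tendsto_const_nhds.sub hv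

theorem QAbsCont.summable {q a x : ℝ} {y : ℝ → E} (hy : QAbsCont q a y) (hx : x ∈ gridStar q a) :
    Summable fun j : ℕ => ‖y (x * q ^ j) - y (x * q ^ (j + 1))‖ :=
  let ⟨_, hK⟩ := hy.2
  summable_of_sum_range_le (fun _ => norm_nonneg _) (hK x hx)

theorem tsum_smul_tsum_smul_add [NormedSpace ℝ E] [CompleteSpace E] {A B : ℕ → ℝ} {d : ℕ → E}
    {C : ℝ} (hA : Summable fun i => ‖A i‖) (hB : ∀ j, ‖B j‖ ≤ C)
    (hd : Summable fun n => ‖d n‖) :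
    ∑' i, A i • ∑' j, B j • d (i + j) =
      ∑' m, (∑ ij ∈ antidiagonal m, A ij.1 * B ij.2) • d m := by
  have hinj : Function.Injective fun ij : ℕ × ℕ => (ij.1, ij.1 + ij.2) := by
    rintro ⟨i, j⟩ ⟨k, l⟩ h
    obtain ⟨hi, hij⟩ : i = k ∧ i + j = k + l := Prod.mk.inj h
    exact Prod.ext hi (by omega)
  have hF : Summable fun ij : ℕ × ℕ => (A ij.1 * B ij.2) • d (ij.1 + ij.2) := by
    refine .of_norm_bounded (((hA.mul_of_nonneg hd (fun _ => norm_nonneg _)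
      (fun _ => norm_nonneg _)).comp_injective hinj).mul_left C) fun ij => ?_
    rw [norm_smul, norm_mul, mul_comm ‖A _‖, mul_assoc]
    exact mul_le_mul_of_nonneg_right (hB _) (by positivity)
  calc ∑' i, A i • ∑' j, B j • d (i + j)
    _ = ∑' i, ∑' j, (A i * B j) • d (i + j) := by simp only [mul_smul, tsum_const_smul'']
    _ = ∑' ij : ℕ × ℕ, (A ij.1 * B ij.2) • d (ij.1 + ij.2) := hF.tsum_prod.symm
    _ = ∑' s : Σ m, antidiagonal m,
          (A s.2.1.1 * B s.2.1.2) • d (s.2.1.1 + s.2.1.2) :=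
      (HasAntidiagonal.sigmaAntidiagonalEquivProd.tsum_eq _).symm
    _ = ∑' m, ∑' ij : antidiagonal m, (A ij.1.1 * B ij.1.2) • d (ij.1.1 + ij.1.2) :=
      (HasAntidiagonal.sigmaAntidiagonalEquivProd.summable_iff.2 hF).tsum_sigma
    _ = ∑' m, (∑ ij ∈ antidiagonal m, A ij.1 * B ij.2) • d m := by
      refine tsum_congr fun m => ?_
      rw [Finset.tsum_subtype _ fun ij : ℕ × ℕ => (A ij.1 * B ij.2) • d (ij.1 + ij.2), sum_smul]
      refine sum_congr rfl fun ij hij => ?_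
      rw [HasAntidiagonal.mem_antidiagonal.1 hij]

end Series

section LeftInt

variable {E : Type*} [NormedAddCommGroup E] [NormedSpace ℝ E] {q α β x : ℝ}

/-- Absolute convergence of the Jackson integral `∫₀ˣ f(t) d_q t`. -/
def QIntegrable (q x : ℝ) (f : ℝ → E) : Prop := Summable fun j : ℕ => ‖q ^ j • f (x * q ^ j)‖

theorem QIntegrable.of_norm_le (hq₀ : 0 < q) (hq₁ : q < 1) {f : ℝ → E} {M : ℝ}
    (hf : ∀ t ∈ grid q x, ‖f t‖ ≤ M) : QIntegrable q x f := by
  refine .of_nonneg_of_le (fun _ => norm_nonneg _) (fun j => ?_)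
    ((summable_geometric_of_lt_one hq₀.le hq₁).mul_right M)
  rw [norm_smul, Real.norm_of_nonneg (by positivity)]
  exact mul_le_mul_of_nonneg_left (hf _ (mul_pow_mem_grid q x j)) (by positivity)

theorem QIntegrable.summable_qBinomCoeff_smul (hq : ‖q‖ < 1) {f : ℝ → E} (hf : QIntegrable q x f)
    (z : ℝ) : Summable fun j : ℕ => ‖(q ^ j * qBinomCoeff q z j) • f (x * q ^ j)‖ := by
  obtain ⟨C, hC⟩ := exists_norm_qBinomCoeff_le hq z
  refine .of_nonneg_of_le (fun _ => norm_nonneg _) (fun j => ?_) (hf.mul_left C)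
  rw [mul_comm, mul_smul, norm_smul]
  exact mul_le_mul_of_nonneg_right (hC j) (norm_nonneg _)

theorem leftInt_zero (q β : ℝ) (f : ℝ → E) : leftInt q β f 0 = 0 := by
  simp [leftInt, jackson, jackson₀]

theorem leftInt_eq_tsum (hq₀ : 0 < q) (hq₁ : q < 1) (hβ : 0 < β) (hx : 0 < x) (f : ℝ → E) :
    leftInt q β f x =
      (((1 - q) * x) ^ β) • ∑' j : ℕ, (q ^ j * qBinomCoeff q (q ^ β) j) • f (x * q ^ j) := by
  have hterm (j : ℕ) : q ^ j • qPoch q (q * (x * q ^ j) / x) (β - 1) • f (x * q ^ j) =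
      (qGamma q β * (1 - q) ^ (β - 1)) •
        ((q ^ j * qBinomCoeff q (q ^ β) j) • f (x * q ^ j)) := by
    have hquot : q * (x * q ^ j) / x = q ^ (j + 1) := by
      rw [pow_succ]
      field_simp
    rw [hquot, qPoch_pow_succ hq₀ hq₁ hβ, smul_smul, smul_smul]
    congr 1
    ring
  have hΓ := qGamma_ne_zero hq₀ hq₁ hβ
  have hq : 0 < 1 - q := sub_pos.2 hq₁
  have hlower (g : ℝ → E) : jackson₀ q 0 g = 0 := by simp [jackson₀]
  rw [leftInt, jackson, hlower, sub_zero, jackson₀, tsum_congr hterm, tsum_const_smul'',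
    smul_smul, smul_smul, Real.mul_rpow hq.le hx.le, Real.rpow_sub_one hx.ne',
    Real.rpow_sub_one hq.ne']
  congr 1
  field_simp

theorem leftInt_congr (hq₀ : 0 < q) (hq₁ : q < 1) (hβ : 0 < β) (hx : 0 < x) {f g : ℝ → E}
    (h : Set.EqOn f g (grid q x)) : leftInt q β f x = leftInt q β g x := by
  simp only [leftInt_eq_tsum hq₀ hq₁ hβ hx, h (mul_pow_mem_grid q x _)]

theorem leftInt_const_smul (hq₀ : 0 < q) (hq₁ : q < 1) (hβ : 0 < β) (hx : 0 < x) (c : ℝ)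
    (f : ℝ → E) : leftInt q β (fun t => c • f t) x = c • leftInt q β f x := by
  simp only [leftInt_eq_tsum hq₀ hq₁ hβ hx, smul_comm _ c, tsum_const_smul'']

theorem leftInt_smul_const (hq₀ : 0 < q) (hq₁ : q < 1) (hβ : 0 < β) (hx : 0 < x) {f : ℝ → ℝ}
    (hf : QIntegrable q x f) (v : E) : leftInt q β (fun t => f t • v) x = leftInt q β f x • v := by
  have h := (hf.summable_qBinomCoeff_smul (norm_lt_one hq₀ hq₁) (q ^ β)).of_norm.tsum_smul_const v
  simp only [leftInt_eq_tsum hq₀ hq₁ hβ hx, smul_assoc] at h ⊢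
  rw [h]

theorem leftInt_sub [CompleteSpace E] (hq₀ : 0 < q) (hq₁ : q < 1) (hβ : 0 < β) (hx : 0 < x)
    {f g : ℝ → E} (hf : QIntegrable q x f) (hg : QIntegrable q x g) :
    leftInt q β (fun t => f t - g t) x = leftInt q β f x - leftInt q β g x := by
  have hq := norm_lt_one hq₀ hq₁
  simp only [leftInt_eq_tsum hq₀ hq₁ hβ hx, smul_sub]
  rw [(hf.summable_qBinomCoeff_smul hq _).of_norm.tsum_sub
    (hg.summable_qBinomCoeff_smul hq _).of_norm, smul_sub]

theorem norm_leftInt_le (hq₀ : 0 < q) (hq₁ : q < 1) (hβ : 0 < β) (hx : 0 < x) {f : ℝ → E}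
    {g : ℝ → ℝ} (hfg : ∀ t ∈ grid q x, ‖f t‖ ≤ g t) (hg : QIntegrable q x g) :
    ‖leftInt q β f x‖ ≤ leftInt q β g x := by
  have hs : 0 ≤ ((1 - q) * x) ^ β :=
    Real.rpow_nonneg (mul_nonneg (sub_nonneg.2 hq₁.le) hx.le) _
  rw [leftInt_eq_tsum hq₀ hq₁ hβ hx, leftInt_eq_tsum hq₀ hq₁ hβ hx, norm_smul,
    Real.norm_of_nonneg hs, smul_eq_mul]
  refine mul_le_mul_of_nonneg_left (tsum_of_norm_bounded
    (hg.summable_qBinomCoeff_smul (norm_lt_one hq₀ hq₁) _).of_norm.hasSum fun j => ?_) hs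
  have hc := mul_nonneg (pow_nonneg hq₀.le j) (qBinomCoeff_rpow_nonneg hq₀ hq₁ hβ.le j)
  rw [norm_smul, Real.norm_of_nonneg hc]
  exact mul_le_mul_of_nonneg_left (hfg _ (mul_pow_mem_grid q x j)) hc

theorem leftInt_leftInt [CompleteSpace E] (hq₀ : 0 < q) (hq₁ : q < 1) (hα : 0 < α) (hβ : 0 < β)
    (hx : 0 < x) {f : ℝ → E} (hf : QIntegrable q x f) :
    leftInt q β (leftInt q α f) x = leftInt q (α + β) f x := by
  have hb : 0 < (1 - q) * x := mul_pos (sub_pos.2 hq₁) hx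
  have hq := norm_lt_one hq₀ hq₁
  set d : ℕ → E := fun n => q ^ n • f (x * q ^ n) with hd
  have hterm (j : ℕ) : (q ^ j * qBinomCoeff q (q ^ β) j) • leftInt q α f (x * q ^ j) =
      ((1 - q) * x) ^ α • (((q ^ α) ^ j * qBinomCoeff q (q ^ β) j) •
        ∑' i : ℕ, qBinomCoeff q (q ^ α) i • d (j + i)) := by
    have hscale : ((1 - q) * (x * q ^ j)) ^ α = ((1 - q) * x) ^ α * (q ^ α) ^ j := by
      rw [← mul_assoc, Real.mul_rpow hb.le (by positivity), Real.rpow_pow_comm hq₀.le]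
    rw [leftInt_eq_tsum hq₀ hq₁ hα (by positivity), hscale, smul_smul, smul_smul,
      ← tsum_const_smul'', ← tsum_const_smul'']
    refine tsum_congr fun i => ?_
    simp only [hd, smul_smul, pow_add, mul_assoc]
    congr 1
    ring
  have hA : Summable fun j => ‖(q ^ α) ^ j * qBinomCoeff q (q ^ β) j‖ := by
    obtain ⟨C, hC⟩ := exists_norm_qBinomCoeff_le hq (q ^ β)
    refine .of_nonneg_of_le (fun _ => norm_nonneg _) (fun j => ?_)
      ((summable_geometric_of_lt_one (by positivity) (Real.rpow_lt_one hq₀.le hq₁ hα)).mul_right C)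
    rw [norm_mul, Real.norm_of_nonneg (by positivity)]
    exact mul_le_mul_of_nonneg_left (hC j) (by positivity)
  obtain ⟨C, hC⟩ := exists_norm_qBinomCoeff_le hq (q ^ α)
  rw [leftInt_eq_tsum hq₀ hq₁ hβ hx, tsum_congr hterm, tsum_const_smul'', smul_smul,
    tsum_smul_tsum_smul_add hA hC hf, leftInt_eq_tsum hq₀ hq₁ (add_pos hα hβ) hx,
    Real.rpow_add hb, mul_comm]
  congr 1
  refine tsum_congr fun m => ?_
  rw [sum_antidiagonal_pow_mul_qBinomCoeff (pow_succ_ne_one hq₀ hq₁), smul_smul,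
    mul_comm (q ^ β), ← Real.rpow_add hq₀, mul_comm]

theorem pow_smul_qDeriv (hq : q ≠ 0) (y : ℝ → E) (x : ℝ) (j : ℕ) :
    q ^ j • qDeriv q y (x * q ^ j) =
      ((1 - q) * x)⁻¹ • (y (x * q ^ j) - y (x * q ^ (j + 1))) := by
  have hj : q ^ j ≠ 0 := pow_ne_zero j hq
  have harg : q * (x * q ^ j) = x * q ^ (j + 1) := by ring
  rw [qDeriv, harg, smul_smul, ← mul_assoc (1 - q), mul_inv_rev, mul_inv_cancel_left₀ hj]

theorem QAbsCont.qIntegrable_qDeriv (hq : q ≠ 0) {a : ℝ} {y : ℝ → E} (hy : QAbsCont q a y)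
    (hx : x ∈ gridStar q a) : QIntegrable q x (qDeriv q y) := by
  simpa only [QIntegrable, pow_smul_qDeriv hq, norm_smul] using
    (hy.summable hx).mul_left ‖((1 - q) * x)⁻¹‖

theorem QAbsCont.leftInt_one_qDeriv [CompleteSpace E] (hq₀ : 0 < q) (hq₁ : q < 1) {a : ℝ}
    (ha : 0 < a) {y : ℝ → E} (hy : QAbsCont q a y) (hx : x ∈ grid q a) :
    leftInt q 1 (qDeriv q y) x = y x - y 0 := by
  have hx₀ := pos_of_mem_grid hq₀ ha hx
  have hb : (1 - q) * x ≠ 0 := mul_ne_zero (sub_pos.2 hq₁).ne' hx₀.ne'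
  rw [leftInt_eq_tsum hq₀ hq₁ one_pos hx₀]
  simp only [Real.rpow_one, qBinomCoeff_self (pow_succ_ne_one hq₀ hq₁), mul_one,
    pow_smul_qDeriv hq₀.ne']
  rw [tsum_const_smul'', smul_inv_smul₀ hb, tsum_sub_succ (hy.1 x (.inl hx))
    (hy.summable (.inl hx)).of_norm, pow_zero, mul_one]

theorem QAbsCont.leftInt_leftCaputo [CompleteSpace E] (hq₀ : 0 < q) (hq₁ : q < 1) {a : ℝ}
    (ha : 0 < a) (hα₀ : 0 < α) (hα₁ : α < 1) {y : ℝ → E} (hy : QAbsCont q a y)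
    (hx : x ∈ grid q a) : leftInt q α (leftCaputo q α y) x = y x - y 0 := by
  rw [← hy.leftInt_one_qDeriv hq₀ hq₁ ha hx, leftCaputo, leftInt_leftInt hq₀ hq₁ (sub_pos.2 hα₁) hα₀
    (pos_of_mem_grid hq₀ ha hx) (hy.qIntegrable_qDeriv hq₀.ne' (.inl hx)), sub_add_cancel]

end LeftInt

section Bounds

theorem norm_le_supNorm {E : Type*} [NormedAddCommGroup E] {q a : ℝ} {f : ℝ → E}
    (hf : ∃ C, ∀ x ∈ gridStar q a, ‖f x‖ ≤ C) {x : ℝ} (hx : x ∈ gridStar q a) :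
    ‖f x‖ ≤ supNorm q a f := by
  obtain ⟨C, hC⟩ := hf
  refine le_csSup ⟨C, ?_⟩ ⟨x, hx, 0, by simp⟩
  rintro _ ⟨z, hz, n, rfl⟩
  exact hC _ (mul_pow_mem_gridStar hz n)

theorem supNorm_nonneg {E : Type*} [NormedAddCommGroup E] (q a : ℝ) (f : ℝ → E) :
    0 ≤ supNorm q a f := by
  refine Real.sSup_nonneg ?_
  rintro _ ⟨z, -, n, rfl⟩
  exact norm_nonneg _

theorem mInf_nonneg (q a : ℝ) (p : ℝ → ℝ) : 0 ≤ mInf q a p := by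
  refine Real.sInf_nonneg ?_
  rintro _ ⟨z, -, rfl⟩
  exact abs_nonneg _

theorem mInf_le_abs {q a : ℝ} (p : ℝ → ℝ) {x : ℝ} (hx : x ∈ grid q a) : mInf q a p ≤ |p x| := by
  refine csInf_le ⟨0, ?_⟩ ⟨x, hx, rfl⟩
  rintro _ ⟨z, -, rfl⟩
  exact abs_nonneg _

theorem ne_zero_of_mInf_pos {q a : ℝ} {p : ℝ → ℝ} (hm : 0 < mInf q a p) {x : ℝ}
    (hx : x ∈ grid q a) : p x ≠ 0 :=
  abs_pos.1 (hm.trans_le (mInf_le_abs p hx))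

theorem exists_norm_leftInt_le {E : Type*} [NormedAddCommGroup E] [NormedSpace ℝ E] {q a β : ℝ}
    (hq₀ : 0 < q) (hq₁ : q < 1) (ha : 0 < a) (hβ : 0 < β) {f : ℝ → E} {M : ℝ}
    (hf : ∀ t ∈ grid q a, ‖f t‖ ≤ M) : ∃ C, ∀ x ∈ gridStar q a, ‖leftInt q β f x‖ ≤ C := by
  have hM : 0 ≤ M := (norm_nonneg _).trans (hf a (self_mem_grid q a))
  have : 0 < 1 - q := sub_pos.2 hq₁
  have hsum : 0 ≤ ∑' j : ℕ, (q ^ j * qBinomCoeff q (q ^ β) j) * M := tsum_nonneg fun j =>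
    mul_nonneg (mul_nonneg (pow_nonneg hq₀.le j) (qBinomCoeff_rpow_nonneg hq₀ hq₁ hβ.le j)) hM
  refine ⟨((1 - q) * a) ^ β * ∑' j : ℕ, (q ^ j * qBinomCoeff q (q ^ β) j) * M, ?_⟩
  rintro x (hx | rfl)
  · have hx₀ := pos_of_mem_grid hq₀ ha hx
    have hxa := le_of_mem_grid hq₀ hq₁ ha hx
    have hint : QIntegrable q x fun _ => M :=
      .of_norm_le hq₀ hq₁ fun _ _ => (Real.norm_of_nonneg hM).le
    refine (norm_leftInt_le hq₀ hq₁ hβ hx₀ (fun t ht => hf t (grid_subset hx ht)) hint).trans ?_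
    simp only [leftInt_eq_tsum hq₀ hq₁ hβ hx₀, smul_eq_mul]
    gcongr
  · rw [leftInt_zero, norm_zero]
    positivity

theorem exists_norm_phi_le {q a α : ℝ} (hq₀ : 0 < q) (hq₁ : q < 1) (ha : 0 < a) (hα : 0 < α) :
    ∃ C, ∀ x ∈ gridStar q a, ‖phi q a α x‖ ≤ C := by
  obtain ⟨C, hC⟩ := exists_rightInt_one_le hq₀ hq₁ ha hα
  refine exists_norm_leftInt_le hq₀ hq₁ ha hα (M := C) fun t ht => ?_
  rw [Real.norm_of_nonneg (rightInt_one_nonneg hq₀ hq₁ ha hα ht)]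
  exact hC t ht

end Bounds

section DoubleInt

variable {E : Type*} [NormedAddCommGroup E] [NormedSpace ℝ E] {q a α : ℝ} {p : ℝ → ℝ}

/-- `I_{q,0⁺}^α [p⁻¹ I_{q,a⁻}^α f]`, the integral operator inverting
`D_{q,a⁻}^α (p ᶜD_{q,0⁺}^α ·)` under zero boundary values. -/
noncomputable def doubleInt (q a α : ℝ) (p : ℝ → ℝ) (f : ℝ → E) : ℝ → E :=
  leftInt q α fun t => (p t)⁻¹ • rightInt q a α f t

theorem norm_inv_smul_rightInt_le (hq₀ : 0 < q) (hq₁ : q < 1) (ha : 0 < a) (hα : 0 < α)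
    (hm : 0 < mInf q a p) {f : ℝ → E} {N : ℝ} (hf : ∀ t ∈ grid q a, ‖f t‖ ≤ N) {x : ℝ}
    (hx : x ∈ grid q a) : ‖(p x)⁻¹ • rightInt q a α f x‖ ≤
      N / mInf q a p * rightInt q a α (fun _ => (1 : ℝ)) x := by
  have : 0 ≤ N := (norm_nonneg _).trans (hf a (self_mem_grid q a))
  have := rightInt_one_nonneg hq₀ hq₁ ha hα hx
  rw [norm_smul, norm_inv, Real.norm_eq_abs, div_mul_eq_mul_div, div_eq_inv_mul]
  gcongr
  · exact mInf_le_abs p hx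
  · exact norm_rightInt_le hq₀ hq₁ ha hα hf hx

theorem qIntegrable_rightInt_one (hq₀ : 0 < q) (hq₁ : q < 1) (ha : 0 < a) (hα : 0 < α) (c : ℝ)
    {x : ℝ} (hx : x ∈ grid q a) :
    QIntegrable q x fun t => c * rightInt q a α (fun _ => (1 : ℝ)) t := by
  obtain ⟨C, hC⟩ := exists_rightInt_one_le hq₀ hq₁ ha hα
  refine .of_norm_le hq₀ hq₁ (M := ‖c‖ * C) fun t ht => ?_
  rw [norm_mul, Real.norm_of_nonneg (rightInt_one_nonneg hq₀ hq₁ ha hα (grid_subset hx ht))]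
  exact mul_le_mul_of_nonneg_left (hC t (grid_subset hx ht)) (norm_nonneg c)

theorem qIntegrable_inv_smul_rightInt (hq₀ : 0 < q) (hq₁ : q < 1) (ha : 0 < a) (hα : 0 < α)
    (hm : 0 < mInf q a p) {f : ℝ → E} {N : ℝ} (hf : ∀ t ∈ grid q a, ‖f t‖ ≤ N) {x : ℝ}
    (hx : x ∈ grid q a) : QIntegrable q x fun t => (p t)⁻¹ • rightInt q a α f t := by
  obtain ⟨C, hC⟩ := exists_rightInt_one_le hq₀ hq₁ ha hα
  have hN : 0 ≤ N := (norm_nonneg _).trans (hf a (self_mem_grid q a))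
  exact .of_norm_le hq₀ hq₁ fun t ht =>
    (norm_inv_smul_rightInt_le hq₀ hq₁ ha hα hm hf (grid_subset hx ht)).trans
      (mul_le_mul_of_nonneg_left (hC t (grid_subset hx ht)) (by positivity))

theorem norm_doubleInt_le (hq₀ : 0 < q) (hq₁ : q < 1) (ha : 0 < a) (hα : 0 < α)
    (hm : 0 < mInf q a p) {f : ℝ → E} {N : ℝ} (hf : ∀ t ∈ grid q a, ‖f t‖ ≤ N) {x : ℝ}
    (hx : x ∈ gridStar q a) :
    ‖doubleInt q a α p f x‖ ≤ N / mInf q a p * phi q a α x := by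
  rcases hx with hx | rfl
  · have hx₀ := pos_of_mem_grid hq₀ ha hx
    rw [phi, ← smul_eq_mul, ← leftInt_const_smul hq₀ hq₁ hα hx₀]
    exact norm_leftInt_le hq₀ hq₁ hα hx₀
      (fun t ht => norm_inv_smul_rightInt_le hq₀ hq₁ ha hα hm hf (grid_subset hx ht))
      (qIntegrable_rightInt_one hq₀ hq₁ ha hα _ hx)
  · rw [doubleInt, phi, leftInt_zero, leftInt_zero, norm_zero, mul_zero]

theorem doubleInt_sub [CompleteSpace E] (hq₀ : 0 < q) (hq₁ : q < 1) (ha : 0 < a) (hα : 0 < α)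
    (hm : 0 < mInf q a p) {f g : ℝ → E} {M N : ℝ} (hf : ∀ t ∈ grid q a, ‖f t‖ ≤ M)
    (hg : ∀ t ∈ grid q a, ‖g t‖ ≤ N) {x : ℝ} (hx : x ∈ grid q a) :
    doubleInt q a α p (fun t => f t - g t) x =
      doubleInt q a α p f x - doubleInt q a α p g x := by
  have hx₀ := pos_of_mem_grid hq₀ ha hx
  simp only [doubleInt]
  rw [← leftInt_sub hq₀ hq₁ hα hx₀ (qIntegrable_inv_smul_rightInt hq₀ hq₁ ha hα hm hf hx)
    (qIntegrable_inv_smul_rightInt hq₀ hq₁ ha hα hm hg hx)]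
  refine leftInt_congr hq₀ hq₁ hα hx₀ fun t ht => ?_
  simp only [rightInt_sub hq₀ hq₁ ha hα f g (grid_subset hx ht), smul_sub]

theorem psi_eq_doubleInt (hq₀ : 0 < q) (hq₁ : q < 1) (ha : 0 < a) (hα : 0 < α) {x : ℝ}
    (hx : x ∈ gridStar q a) : psi q a α p x = doubleInt q a α p (pointMass q a (1 : ℝ)) x := by
  rcases hx with hx | rfl
  · refine leftInt_congr hq₀ hq₁ hα (pos_of_mem_grid hq₀ ha hx) fun t ht => ?_
    simp only [rightInt_pointMass hq₀ hq₁ ha hα _ (grid_subset hx ht), smul_eq_mul, mul_one]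
    rw [← div_div, div_eq_inv_mul _ (p t)]
  · rw [psi, doubleInt, leftInt_zero, leftInt_zero]

theorem doubleInt_pointMass (hq₀ : 0 < q) (hq₁ : q < 1) (ha : 0 < a) (hα : 0 < α)
    (hm : 0 < mInf q a p) (v : E) {x : ℝ} (hx : x ∈ grid q a) :
    doubleInt q a α p (pointMass q a v) x = psi q a α p x • v := by
  have hx₀ := pos_of_mem_grid hq₀ ha hx
  have hint : QIntegrable q x fun t => (p t)⁻¹ • rightInt q a α (pointMass q a (1 : ℝ)) t :=
    qIntegrable_inv_smul_rightInt hq₀ hq₁ ha hα hm (fun t _ => norm_pointMass_le q a 1 t) hx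
  rw [psi_eq_doubleInt hq₀ hq₁ ha hα (.inl hx), doubleInt, doubleInt,
    ← leftInt_smul_const hq₀ hq₁ hα hx₀ hint]
  refine leftInt_congr hq₀ hq₁ hα hx₀ fun t ht => ?_
  simp only [rightInt_pointMass hq₀ hq₁ ha hα _ (grid_subset hx ht), smul_smul, smul_eq_mul,
    mul_one]

theorem exists_norm_psi_le (hq₀ : 0 < q) (hq₁ : q < 1) (ha : 0 < a) (hα : 0 < α)
    (hm : 0 < mInf q a p) : ∃ C, ∀ x ∈ gridStar q a, ‖psi q a α p x‖ ≤ C := by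
  obtain ⟨C, hC⟩ := exists_norm_phi_le hq₀ hq₁ ha hα
  refine ⟨‖((1 - q) * a)⁻¹ • (1 : ℝ)‖ / mInf q a p * C, fun x hx => ?_⟩
  rw [psi_eq_doubleInt hq₀ hq₁ ha hα hx]
  refine (norm_doubleInt_le hq₀ hq₁ ha hα hm (fun t _ => norm_pointMass_le q a 1 t) hx).trans ?_
  gcongr
  exact (le_abs_self _).trans (hC x hx)

end DoubleInt

section Coefficients

variable {q a α : ℝ} {p : ℝ → ℝ}

theorem exists_norm_coefA_le (hq₀ : 0 < q) (hq₁ : q < 1) (ha : 0 < a) (hα : 0 < α)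
    (hm : 0 < mInf q a p) (c₁ c₂ d₁ d₂ : ℝ) :
    ∃ C, ∀ x ∈ gridStar q a, ‖coefA q a α p c₁ c₂ d₁ d₂ x‖ ≤ C := by
  obtain ⟨C, hC⟩ := exists_norm_psi_le hq₀ hq₁ ha hα hm
  refine ⟨‖c₂ / bdet q a α p c₁ c₂ d₁ d₂‖ * (‖d₂‖ + ‖d₁‖ * (‖psi q a α p a‖ + C)), fun x hx => ?_⟩
  rw [coefA, norm_mul]
  gcongr
  refine (norm_add_le _ _).trans ?_
  rw [norm_mul]
  gcongr
  exact (norm_sub_le _ _).trans (by gcongr; exact hC x hx)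

theorem exists_norm_coefB_le (hq₀ : 0 < q) (hq₁ : q < 1) (ha : 0 < a) (hα : 0 < α)
    (hm : 0 < mInf q a p) (c₁ c₂ d₁ d₂ : ℝ) :
    ∃ C, ∀ x ∈ gridStar q a, ‖coefB q a α p c₁ c₂ d₁ d₂ x‖ ≤ C := by
  obtain ⟨C, hC⟩ := exists_norm_psi_le hq₀ hq₁ ha hα hm
  refine ⟨‖d₁ / bdet q a α p c₁ c₂ d₁ d₂‖ * (‖c₁‖ * C + ‖c₂‖), fun x hx => ?_⟩
  rw [coefB, norm_mul]
  gcongr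
  refine (norm_sub_le _ _).trans ?_
  rw [norm_mul]
  gcongr
  exact hC x hx

end Coefficients

section QInvDeriv

variable {E : Type*} [NormedAddCommGroup E] [NormedSpace ℝ E] {q a : ℝ} {f u : ℝ → E}

theorem HasQInvDerivAt.eq_sub (hq₀ : 0 < q) (hq₁ : q < 1) {x : ℝ} (hx : x ≠ 0) {v : E}
    (h : HasQInvDerivAt q a u (q • v) x) : u x = u (x / q) - ((1 - q) * x) • v := by
  have hq : 1 - q ≠ 0 := (sub_pos.2 hq₁).ne'
  have hne : x - x / q ≠ 0 := by
    rw [show x - x / q = -((1 - q) * x / q) by field_simp; ring]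
    exact neg_ne_zero.2 (div_ne_zero (mul_ne_zero hq hx) hq₀.ne')
  have hdiff : u x - u (x / q) = ((x - x / q) * q) • v := by
    rw [← (eq_inv_smul_iff₀ hne).1 (h.1 hx), smul_smul]
  rw [show (1 - q) * x = -((x - x / q) * q) by field_simp; ring, neg_smul, sub_neg_eq_add, ← hdiff,
    add_sub_cancel]

theorem eq_sub_rightInt_one (hq₀ : 0 < q) (hq₁ : q < 1) (ha : 0 < a)
    (h : ∀ x ∈ grid q a, HasQInvDerivAt q a u (q • f x) x) {x : ℝ} (hx : x ∈ grid q a) :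
    u x = u (a / q) - rightInt q a 1 f x := by
  have hstep (n : ℕ) := (h _ (mul_pow_mem_grid q a n)).eq_sub hq₀ hq₁
    (pos_of_mem_grid hq₀ ha (mul_pow_mem_grid q a n)).ne'
  obtain ⟨n, rfl⟩ := hx
  rw [rightInt_one_eq_sum hq₀ hq₁ ha]
  induction n with
  | zero => simpa using hstep 0
  | succ n ih =>
    have hdiv : a * q ^ (n + 1) / q = a * q ^ n := by rw [pow_succ]; field_simp
    rw [hstep, hdiv, ih, sum_range_succ _ (n + 1), smul_add, smul_smul, ← sub_sub, mul_assoc]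

theorem tendsto_of_hasQInvDerivAt_zero (hq₀ : 0 < q) (hq₁ : q < 1) (ha : 0 < a) {v : E}
    (h : HasQInvDerivAt q a u v 0) :
    Tendsto (fun n : ℕ => u (a * q ^ n)) atTop (𝓝 (u 0)) := by
  have hgrid : Tendsto (fun n : ℕ => a * q ^ n) atTop (𝓝 0) := by
    simpa using (tendsto_pow_atTop_nhds_zero_of_lt_one hq₀.le hq₁).const_mul a
  rw [← tendsto_sub_nhds_zero_iff, ← zero_smul ℝ v]
  refine (hgrid.smul (h.2 rfl)).congr fun n => smul_inv_smul₀ ?_ _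
  exact (pos_of_mem_grid hq₀ ha (mul_pow_mem_grid q a n)).ne'

theorem norm_rightInt_one_le (hq₀ : 0 < q) (hq₁ : q < 1) (ha : 0 < a) {N : ℝ}
    (hf : ∀ t ∈ grid q a, ‖f t‖ ≤ N) {x : ℝ} (hx : x ∈ grid q a) :
    ‖rightInt q a 1 f x‖ ≤ a * N := by
  obtain ⟨n, rfl⟩ := hx
  have hN : 0 ≤ N := (norm_nonneg _).trans (hf a (self_mem_grid q a))
  have : 0 < 1 - q := sub_pos.2 hq₁
  have hgeom : (1 - q) * ∑ k ∈ range (n + 1), q ^ k ≤ 1 := by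
    rw [mul_neg_geom_sum]
    exact sub_le_self _ (by positivity)
  calc ‖rightInt q a 1 f (a * q ^ n)‖
      ≤ ((1 - q) * a) * ∑ k ∈ range (n + 1), q ^ k * N := by
        rw [rightInt_one_eq_sum hq₀ hq₁ ha, norm_smul, Real.norm_of_nonneg (by positivity)]
        gcongr
        refine norm_sum_le_of_le _ fun k _ => ?_
        rw [norm_smul, Real.norm_of_nonneg (by positivity)]
        exact mul_le_mul_of_nonneg_left (hf _ (mul_pow_mem_grid q a k)) (by positivity)
    _ = ((1 - q) * ∑ k ∈ range (n + 1), q ^ k) * (a * N) := by rw [← sum_mul]; ring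
    _ ≤ a * N := mul_le_of_le_one_left (by positivity) hgeom

theorem norm_sub_le_of_hasQInvDerivAt (hq₀ : 0 < q) (hq₁ : q < 1) (ha : 0 < a)
    (h : ∀ x ∈ gridStar q a, HasQInvDerivAt q a u (q • f x) x) {N : ℝ}
    (hf : ∀ t ∈ grid q a, ‖f t‖ ≤ N) : ‖u (a / q) - u 0‖ ≤ a * N := by
  have hlim := tendsto_of_hasQInvDerivAt_zero hq₀ hq₁ ha (h 0 (.inr rfl))
  refine le_of_tendsto (hlim.const_sub (u (a / q))).norm (.of_forall fun n => ?_)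
  have hx := mul_pow_mem_grid q a n
  rw [eq_sub_rightInt_one hq₀ hq₁ ha (fun x hx => h x (.inl hx)) hx, sub_sub_cancel]
  exact norm_rightInt_one_le hq₀ hq₁ ha hf hx

end QInvDeriv

section ForcedProblem

variable {E : Type*} [NormedAddCommGroup E] [NormedSpace ℝ E] {q a α c₁ c₂ d₁ d₂ : ℝ} {p : ℝ → ℝ}
  {f u y : ℝ → E}

/-- `y` solves `D_{q,a⁻}^α (p ᶜD_{q,0⁺}^α y) = -f` on `A*_{q,a}` together with both boundary
conditions. As in `SolvesWith`, `u` stands for `I_{q,a⁻}^{1-α} (p ᶜD_{q,0⁺}^α y)`, here prescribed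
on `A_{q,a}` only. -/
structure IsForcedSolution (q a α : ℝ) (p : ℝ → ℝ) (c₁ c₂ d₁ d₂ : ℝ) (f u y : ℝ → E) : Prop where
  absCont : QAbsCont q a y
  flux_eq : Set.EqOn u (rightInt q a (1 - α) fun t => p t • leftCaputo q α y t) (grid q a)
  hasQInvDerivAt : ∀ x ∈ gridStar q a, HasQInvDerivAt q a u (q • f x) x
  left_boundary : c₁ • y 0 + c₂ • u 0 = 0
  right_boundary : d₁ • y a + d₂ • u (a / q) = 0

namespace IsForcedSolution

theorem smul_leftCaputo_eqOn (h : IsForcedSolution q a α p c₁ c₂ d₁ d₂ f u y) (hq₀ : 0 < q)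
    (hq₁ : q < 1) (ha : 0 < a) (hα₀ : 0 < α) (hα₁ : α < 1) :
    Set.EqOn (fun t => p t • leftCaputo q α y t)
      (rightInt q a α fun t => pointMass q a (u (a / q)) t - f t) (grid q a) := by
  refine eqOn_of_rightInt_eqOn hq₀ hq₁ ha (sub_pos.2 hα₁) fun x hx => ?_
  rw [← h.flux_eq hx, rightInt_rightInt hq₀ hq₁ ha hα₀ (sub_pos.2 hα₁) _ hx, add_sub_cancel,
    rightInt_sub hq₀ hq₁ ha one_pos _ _ hx, rightInt_one_pointMass hq₀ hq₁ ha _ hx]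
  exact eq_sub_rightInt_one hq₀ hq₁ ha (fun x hx => h.hasQInvDerivAt x (.inl hx)) hx

theorem eq_add_psi_smul_sub [CompleteSpace E] (h : IsForcedSolution q a α p c₁ c₂ d₁ d₂ f u y)
    (hq₀ : 0 < q) (hq₁ : q < 1) (ha : 0 < a) (hα₀ : 0 < α) (hα₁ : α < 1) (hm : 0 < mInf q a p)
    {N : ℝ} (hf : ∀ t ∈ grid q a, ‖f t‖ ≤ N) {x : ℝ} (hx : x ∈ grid q a) :
    y x = y 0 + psi q a α p x • u (a / q) - doubleInt q a α p f x := by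
  have hcaputo : Set.EqOn (leftCaputo q α y)
      (fun t => (p t)⁻¹ • rightInt q a α (fun t => pointMass q a (u (a / q)) t - f t) t)
      (grid q a) := fun t ht =>
    (eq_inv_smul_iff₀ (ne_zero_of_mInf_pos hm ht)).2
      (h.smul_leftCaputo_eqOn hq₀ hq₁ ha hα₀ hα₁ ht)
  have hdiff : y x - y 0 = psi q a α p x • u (a / q) - doubleInt q a α p f x := calc
    y x - y 0 = leftInt q α (leftCaputo q α y) x :=
      (h.absCont.leftInt_leftCaputo hq₀ hq₁ ha hα₀ hα₁ hx).symm
    _ = doubleInt q a α p (fun t => pointMass q a (u (a / q)) t - f t) x :=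
      leftInt_congr hq₀ hq₁ hα₀ (pos_of_mem_grid hq₀ ha hx) fun t ht => hcaputo (grid_subset hx ht)
    _ = psi q a α p x • u (a / q) - doubleInt q a α p f x := by
      rw [doubleInt_sub hq₀ hq₁ ha hα₀ hm (fun t _ => norm_pointMass_le q a (u (a / q)) t) hf hx,
        doubleInt_pointMass hq₀ hq₁ ha hα₀ hm _ hx]
  rw [add_sub_assoc, ← hdiff, add_sub_cancel]

theorem eq_coef_smul [CompleteSpace E] (h : IsForcedSolution q a α p c₁ c₂ d₁ d₂ f u y)
    (hq₀ : 0 < q) (hq₁ : q < 1) (ha : 0 < a) (hα₀ : 0 < α) (hα₁ : α < 1) (hm : 0 < mInf q a p)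
    (hΔ : bdet q a α p c₁ c₂ d₁ d₂ ≠ 0) {N : ℝ} (hf : ∀ t ∈ grid q a, ‖f t‖ ≤ N) {x : ℝ}
    (hx : x ∈ grid q a) :
    y x = coefA q a α p c₁ c₂ d₁ d₂ x • (u (a / q) - u 0) +
      coefB q a α p c₁ c₂ d₁ d₂ x • doubleInt q a α p f a - doubleInt q a α p f x := by
  have hA : bdet q a α p c₁ c₂ d₁ d₂ * coefA q a α p c₁ c₂ d₁ d₂ x =
      c₂ * (d₂ + d₁ * (psi q a α p a - psi q a α p x)) := by
    rw [coefA, ← mul_assoc, mul_div_cancel₀ _ hΔ]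
  have hB : bdet q a α p c₁ c₂ d₁ d₂ * coefB q a α p c₁ c₂ d₁ d₂ x =
      d₁ * (c₁ * psi q a α p x - c₂) := by
    rw [coefB, ← mul_assoc, mul_div_cancel₀ _ hΔ]
  have hya := h.right_boundary
  rw [h.eq_add_psi_smul_sub hq₀ hq₁ ha hα₀ hα₁ hm hf (self_mem_grid q a)] at hya
  rw [h.eq_add_psi_smul_sub hq₀ hq₁ ha hα₀ hα₁ hm hf hx]
  refine smul_right_injective E hΔ ?_
  simp only [smul_sub, smul_add, smul_smul, hA, hB]
  simp only [bdet]
  linear_combination (norm := module)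
    (d₂ + d₁ * (psi q a α p a - psi q a α p x)) • h.left_boundary +
      (c₁ * psi q a α p x - c₂) • hya

end IsForcedSolution

/-- The constant `M_φ + B φ(a) + A a m_p`: a solution with right-hand side bounded by `N` is bounded
by `N / m_p` times it. -/
noncomputable def solutionBound (q a α : ℝ) (p : ℝ → ℝ) (c₁ c₂ d₁ d₂ : ℝ) : ℝ :=
  supNorm q a (phi q a α) + supNorm q a (coefB q a α p c₁ c₂ d₁ d₂) * phi q a α a +
    supNorm q a (coefA q a α p c₁ c₂ d₁ d₂) * a * mInf q a p

namespace IsForcedSolution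

theorem mInf_mul_norm_le [CompleteSpace E] (h : IsForcedSolution q a α p c₁ c₂ d₁ d₂ f u y)
    (hq₀ : 0 < q) (hq₁ : q < 1) (ha : 0 < a) (hα₀ : 0 < α) (hα₁ : α < 1) (hm : 0 < mInf q a p)
    (hΔ : bdet q a α p c₁ c₂ d₁ d₂ ≠ 0) {N : ℝ} (hf : ∀ t ∈ grid q a, ‖f t‖ ≤ N) {x : ℝ}
    (hx : x ∈ grid q a) :
    mInf q a p * ‖y x‖ ≤ solutionBound q a α p c₁ c₂ d₁ d₂ * N := by
  have hN : 0 ≤ N := (norm_nonneg _).trans (hf a (self_mem_grid q a))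
  have hx' : x ∈ gridStar q a := .inl hx
  have hA := norm_le_supNorm (exists_norm_coefA_le hq₀ hq₁ ha hα₀ hm c₁ c₂ d₁ d₂) hx'
  have hB := norm_le_supNorm (exists_norm_coefB_le hq₀ hq₁ ha hα₀ hm c₁ c₂ d₁ d₂) hx'
  have hφ := (le_abs_self _).trans (norm_le_supNorm (exists_norm_phi_le hq₀ hq₁ ha hα₀) hx')
  have hu := norm_sub_le_of_hasQInvDerivAt hq₀ hq₁ ha h.hasQInvDerivAt hf
  have hI := norm_doubleInt_le hq₀ hq₁ ha hα₀ hm hf hx'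
  have hIa := norm_doubleInt_le hq₀ hq₁ ha hα₀ hm hf (x := a) (.inl (self_mem_grid q a))
  have hy : ‖y x‖ ≤ supNorm q a (coefA q a α p c₁ c₂ d₁ d₂) * (a * N) +
      supNorm q a (coefB q a α p c₁ c₂ d₁ d₂) * (N / mInf q a p * phi q a α a) +
      N / mInf q a p * supNorm q a (phi q a α) := by
    rw [h.eq_coef_smul hq₀ hq₁ ha hα₀ hα₁ hm hΔ hf hx]
    refine (norm_sub_le _ _).trans (add_le_add ((norm_add_le _ _).trans (add_le_add ?_ ?_)) ?_)
    · rw [norm_smul]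
      exact mul_le_mul hA hu (norm_nonneg _) (supNorm_nonneg _ _ _)
    · rw [norm_smul]
      exact mul_le_mul hB hIa (norm_nonneg _) (supNorm_nonneg _ _ _)
    · exact hI.trans (mul_le_mul_of_nonneg_left hφ (div_nonneg hN hm.le))
  refine (mul_le_mul_of_nonneg_left hy hm.le).trans_eq ?_
  rw [solutionBound]
  field_simp
  ring

theorem eqOn_zero [CompleteSpace E] (h : IsForcedSolution q a α p c₁ c₂ d₁ d₂ f u y)
    (hq₀ : 0 < q) (hq₁ : q < 1) (ha : 0 < a) (hα₀ : 0 < α) (hα₁ : α < 1)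
    (hΔ : bdet q a α p c₁ c₂ d₁ d₂ ≠ 0) {H : ℝ} (hH₀ : 0 ≤ H)
    (hH : H < mInf q a p / solutionBound q a α p c₁ c₂ d₁ d₂)
    (hf : ∀ t ∈ grid q a, ‖f t‖ ≤ H * ‖y t‖) : Set.EqOn y 0 (gridStar q a) := by
  have hquot := hH₀.trans_lt hH
  have hm : 0 < mInf q a p := (mInf_nonneg q a p).lt_of_ne' fun h0 => by simp [h0] at hquot
  have hL : 0 < solutionBound q a α p c₁ c₂ d₁ d₂ := (div_pos_iff_of_pos_left hm).1 hquot
  have hlim : Tendsto (fun n : ℕ => y (a * q ^ n)) atTop (𝓝 (y 0)) :=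
    h.absCont.1 a (.inl (self_mem_grid q a))
  set S := ⨆ n : ℕ, ‖y (a * q ^ n)‖
  have hS (n : ℕ) : ‖y (a * q ^ n)‖ ≤ S := le_ciSup hlim.norm.bddAbove_range n
  have hfS : ∀ t ∈ grid q a, ‖f t‖ ≤ H * S := by
    rintro t ⟨n, rfl⟩
    exact (hf _ (mul_pow_mem_grid q a n)).trans (mul_le_mul_of_nonneg_left (hS n) hH₀)
  have hcontr : S ≤ solutionBound q a α p c₁ c₂ d₁ d₂ * (H * S) / mInf q a p :=
    ciSup_le fun n => (le_div_iff₀' hm).2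
      (h.mInf_mul_norm_le hq₀ hq₁ ha hα₀ hα₁ hm hΔ hfS (mul_pow_mem_grid q a n))
  have hS₀ : S ≤ 0 := by
    rw [lt_div_iff₀ hL] at hH
    rw [le_div_iff₀ hm] at hcontr
    nlinarith
  have hy (n : ℕ) : y (a * q ^ n) = 0 := norm_le_zero_iff.1 ((hS n).trans hS₀)
  rintro x (⟨n, rfl⟩ | rfl)
  · exact hy n
  · simp only [hy] at hlim
    exact tendsto_nhds_unique hlim tendsto_const_nhds

end IsForcedSolution

end ForcedProblem

section Eigenvalues

variable {𝕜 : Type*} [RCLike 𝕜] {q a α c₁ c₂ d₁ d₂ : ℝ} {p r w : ℝ → ℝ} {lam : 𝕜} {u y : ℝ → 𝕜}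

theorem SolvesWith.isForcedSolution (h : SolvesWith q a r w c₁ c₂ d₁ d₂ lam u y) (hq₀ : 0 < q)
    (hu : Set.EqOn u (flux q a α p y) (gridStar q a)) :
    IsForcedSolution q a α p c₁ c₂ d₁ d₂
      (fun x => ((r x : 𝕜) - lam * (w x : 𝕜)) * y x) u y := by
  obtain ⟨hy, heq, hleft, hright⟩ := h
  refine ⟨hy, fun x hx => hu (.inl hx), fun x hx => ?_, hleft, hright⟩
  obtain ⟨d, hd, he⟩ := heq x hx
  have hq : (q : 𝕜) ≠ 0 := RCLike.ofReal_ne_zero.2 hq₀.ne'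
  suffices hdq : d = q • (((r x : 𝕜) - lam * (w x : 𝕜)) * y x) from hdq ▸ hd
  simp only [RCLike.real_smul_eq_coe_mul] at he ⊢
  push_cast at he
  field_simp at he
  linear_combination -he

theorem IsSolutionExt.eqOn_zero (h : IsSolutionExt q a α p r w c₁ c₂ d₁ d₂ lam y) (hq₀ : 0 < q)
    (hq₁ : q < 1) (ha : 0 < a) (hα₀ : 0 < α) (hα₁ : α < 1) (hΔ : bdet q a α p c₁ c₂ d₁ d₂ ≠ 0)
    (hbdd : ∃ C : ℝ, ∀ x ∈ gridStar q a, ‖(r x : 𝕜) - lam * (w x : 𝕜)‖ ≤ C)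
    (hlam : supNorm q a (fun x => (r x : 𝕜) - lam * (w x : 𝕜)) <
      mInf q a p / solutionBound q a α p c₁ c₂ d₁ d₂) :
    Set.EqOn y 0 (gridStar q a) := by
  obtain ⟨u, hu, hy⟩ := h
  refine (hy.isForcedSolution hq₀ hu).eqOn_zero hq₀ hq₁ ha hα₀ hα₁ hΔ (supNorm_nonneg q a _) hlam
    fun t ht => ?_
  rw [norm_mul]
  exact mul_le_mul_of_nonneg_right (norm_le_supNorm hbdd (.inl ht)) (norm_nonneg _)

theorem flux_zero (q a α : ℝ) (p : ℝ → ℝ) : flux q a α p (0 : ℝ → 𝕜) = 0 := by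
  funext x
  simp [flux, leftCaputo, leftInt, qDeriv, rightInt, jackson, jackson₀]

theorem isSolution_zero (q a α : ℝ) (p r w : ℝ → ℝ) (c₁ c₂ d₁ d₂ : ℝ) (lam : 𝕜) :
    IsSolution q a α p r w c₁ c₂ d₁ d₂ lam 0 := by
  rw [IsSolution, flux_zero]
  exact ⟨⟨fun x _ => by simp, 0, fun u _ N => by simp⟩,
    fun x _ => ⟨0, ⟨by simp, by simp⟩, by simp⟩, by simp, by simp⟩

theorem IsSolution.isSolutionExt (h : IsSolution q a α p r w c₁ c₂ d₁ d₂ lam y) :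
    IsSolutionExt q a α p r w c₁ c₂ d₁ d₂ lam y :=
  ⟨_, Set.eqOn_refl _ _, h⟩

theorem uniquelySolvable_and_simple {Sol : (ℝ → 𝕜) → Prop} (h0 : Sol 0)
    (h : ∀ z, Sol z → Set.EqOn z 0 (gridStar q a)) :
    UniquelySolvable q a Sol ∧ SimpleIfEigenvalue q a Sol :=
  ⟨⟨0, h0, h⟩, fun y z _ hz => ⟨0, fun x hx => by simp [h z hz.1 hx]⟩⟩

end Eigenvalues

end QFSLP

theorem theorem3p6_general {𝕜 : Type*} [RCLike 𝕜] (q a α : ℝ) (hq₀ : 0 < q) (hq₁ : q < 1)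
    (ha : 0 < a) (hα₀ : 0 < α) (hα₁ : α < 1) (p r w : ℝ → ℝ) (c₁ c₂ d₁ d₂ : ℝ)
    (hΔ : QFSLP.bdet q a α p c₁ c₂ d₁ d₂ ≠ 0) (lam : 𝕜)
    (hbdd : ∃ C : ℝ, ∀ x ∈ QFSLP.gridStar q a, ‖(r x : 𝕜) - lam * (w x : 𝕜)‖ ≤ C)
    (hlam : QFSLP.supNorm q a (fun x => (r x : 𝕜) - lam * (w x : 𝕜)) <
      QFSLP.mInf q a p /
        (QFSLP.supNorm q a (QFSLP.phi q a α) +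
          QFSLP.supNorm q a (QFSLP.coefB q a α p c₁ c₂ d₁ d₂) * QFSLP.phi q a α a +
          QFSLP.supNorm q a (QFSLP.coefA q a α p c₁ c₂ d₁ d₂) * a * QFSLP.mInf q a p)) :
    (QFSLP.UniquelySolvable q a (QFSLP.IsSolution q a α p r w c₁ c₂ d₁ d₂ lam) ∧
      QFSLP.SimpleIfEigenvalue q a (QFSLP.IsSolution q a α p r w c₁ c₂ d₁ d₂ lam)) ∧
    (QFSLP.UniquelySolvable q a (QFSLP.IsSolutionExt q a α p r w c₁ c₂ d₁ d₂ lam) ∧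
      QFSLP.SimpleIfEigenvalue q a (QFSLP.IsSolutionExt q a α p r w c₁ c₂ d₁ d₂ lam)) := by
  have hext : ∀ z, QFSLP.IsSolutionExt q a α p r w c₁ c₂ d₁ d₂ lam z →
      Set.EqOn z 0 (QFSLP.gridStar q a) := fun z hz =>
    hz.eqOn_zero hq₀ hq₁ ha hα₀ hα₁ hΔ hbdd hlam
  have h0 := QFSLP.isSolution_zero q a α p r w c₁ c₂ d₁ d₂ lam
  exact ⟨QFSLP.uniquelySolvable_and_simple h0 fun z hz => hext z hz.isSolutionExt,
    QFSLP.uniquelySolvable_and_simple h0.isSolutionExt hext⟩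

theorem theorem3p6 {𝕜 : Type*} [RCLike 𝕜] (q a α : ℝ) (hq₀ : 0 < q) (hq₁ : q < 1) (ha : 0 < a)
    (hα₀ : 0 < α) (hα₁ : α < 1) (p r w : ℝ → ℝ)
    (hp : ∀ x ∈ QFSLP.gridStar q a, p x ≠ 0) (hw : ∀ x ∈ QFSLP.gridStar q a, 0 < w x)
    (c₁ c₂ d₁ d₂ : ℝ) (hc : c₁ ^ 2 + c₂ ^ 2 ≠ 0) (hd : d₁ ^ 2 + d₂ ^ 2 ≠ 0)
    (hΔ : QFSLP.bdet q a α p c₁ c₂ d₁ d₂ ≠ 0) (lam : 𝕜)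
    (hbdd : ∃ C : ℝ, ∀ x ∈ QFSLP.gridStar q a, ‖(r x : 𝕜) - lam * (w x : 𝕜)‖ ≤ C)
    (hlam : QFSLP.supNorm q a (fun x => (r x : 𝕜) - lam * (w x : 𝕜)) <
      QFSLP.mInf q a p /
        (QFSLP.supNorm q a (QFSLP.phi q a α) +
          QFSLP.supNorm q a (QFSLP.coefB q a α p c₁ c₂ d₁ d₂) * QFSLP.phi q a α a +
          QFSLP.supNorm q a (QFSLP.coefA q a α p c₁ c₂ d₁ d₂) * a * QFSLP.mInf q a p)) :
    (QFSLP.UniquelySolvable q a (QFSLP.IsSolution q a α p r w c₁ c₂ d₁ d₂ lam) ∧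
      QFSLP.SimpleIfEigenvalue q a (QFSLP.IsSolution q a α p r w c₁ c₂ d₁ d₂ lam)) ∧
    (QFSLP.UniquelySolvable q a (QFSLP.IsSolutionExt q a α p r w c₁ c₂ d₁ d₂ lam) ∧
      QFSLP.SimpleIfEigenvalue q a (QFSLP.IsSolutionExt q a α p r w c₁ c₂ d₁ d₂ lam)) :=
  theorem3p6_general q a α hq₀ hq₁ ha hα₀ hα₁ p r w c₁ c₂ d₁ d₂ hΔ lam hbdd hlam
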